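/- **Theorem 3.10 (Neveu decomposition).** Let $M\subseteq\mathcal B(\mathcal H)$ be a $\sigma$-finite semifinite von Neumann algebra (i.e. $M$ carries a faithful normal semifinite trace) with predual $M_*$. Let $G$ be a locally compact, second countable, Hausdorff topological semigroup with a $\sigma$-finite Borel measure $m$ such that $m(uB)=m(B)=m(Bu)$ for all $u\in G$ and all Borel $B\subseteq G$. Let $(K_n)$ be a two-sided Følner net of measurable subsets of $G$, that is, $0<m(K_n)<\infty$ for all $n$, and $$\lim_n \frac{m(K_n\,\Delta\, K_ng)}{m(K_n)}=0=\lim_n \frac{m(K_n\,\Delta\, gK_n)}{m(K_n)}\qquad\text{for all } g\in G,$$ indexed by a directed set whose order filter is countably generated (e.g. $\mathbb N$ or $\mathbb R_+$). Let $\alpha=(\alpha_g)_{g\in G}$ be an action ($\alpha_g\alpha_h=\alpha_{gh}$) or an anti-action ($\alpha_g\alpha_h=\alpha_{hg}$) of $G$ on $M$ by normal positive linear maps with $\|\alpha_g\|\le 1$ and $\alpha_g(1)\le 1$, such that $g\mapsto\alpha_g(x)$ is weak-$*$ continuous for every $x\in M$. For $x\in M$ let $A_n(x)=\frac1{m(K_n)}\int_{K_n}\alpha_g(x)\,dm(g)$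 (weak-$*$ integral). A positive $x\in M$ is called *weakly wandering* if $\lim_n\|A_n(x)\|=0$. A functional $\rho$ on $M$ is called *$G$-invariant* if $\rho\circ\alpha_g=\rho$ for all $g\in G$. The support $s(x)$ of a positive $x\in M$ is the smallest projection $p\in M$ with $px=x$. The support $s(\rho)$ of a normal state $\rho$ is $1-p$, where $p$ is the largest projection in $M$ with $\rho(p)=0$. Then there are projections $e_1,e_2\in M$ with $e_1+e_2=1$ such that 1. there is a $G$-invariant normal state $\rho$ on $M$ with $s(\rho)=e_1$, or else $M$ has no $G$-invariant normal state and $e_1=0$; and 2. there is a weakly wandering operator $x_0\in M$ with $s(x_0)=e_2$. Moreover, the pair $(e_1,e_2)$ of projections with $e_1+e_2=1$ satisfying 1 and 2 is unique. -/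

import Mathlib

open scoped ComplexOrder NNReal ENNReal

namespace Neveu

section Algebra

variable {H : Type*} [NormedAddCommGroup H] [InnerProductSpace ℂ H] [CompleteSpace H]

/-- The algebra `M` as a type: the operators on `H` that belong to `M`, with the operator norm and
the order of operators (`0 ≤ x` if and only if `x` is a positive operator). -/
abbrev Elt (M : VonNeumannAlgebra H) : Type _ := M.toStarSubalgebra

variable {M : VonNeumannAlgebra H}

/-- A linear functional belongs to the predual `M_*`, i.e. it is continuous for the ultraweak
topology: `φ x = ∑ₙ ⟪ξₙ, x ηₙ⟫` with `∑ ‖ξₙ‖² < ∞` and `∑ ‖ηₙ‖² < ∞`. -/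
def IsNormal (φ : Elt M →ₗ[ℂ] ℂ) : Prop :=
  ∃ ξ η : ℕ → H, Summable (fun n => ‖ξ n‖ ^ 2) ∧ Summable (fun n => ‖η n‖ ^ 2) ∧
    ∀ x : Elt M, HasSum (fun n => inner ℂ (ξ n) ((x : H →L[ℂ] H) (η n))) (φ x)

/-- A normal state: a positive normal linear functional with value `1` at the identity. -/
structure IsNormalState (ρ : Elt M →ₗ[ℂ] ℂ) : Prop where
  normal : IsNormal ρ
  nonneg : ∀ x : Elt M, 0 ≤ ρ (star x * x)
  map_one : ρ 1 = 1

/-- `e = s(ρ)`: the projection `1 - e` is the largest projection on which `ρ` vanishes. -/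
def IsFunctionalSupport (ρ : Elt M →ₗ[ℂ] ℂ) (e : Elt M) : Prop :=
  IsGreatest {p : Elt M | IsStarProjection p ∧ ρ p = 0} (1 - e)

/-- `e = s(x)` for self-adjoint `x`: the smallest projection of `M` with `e x = x`. -/
def IsOperatorSupport (x e : Elt M) : Prop :=
  IsLeast {p : Elt M | IsStarProjection p ∧ p * x = x} e

/-- `M` is `σ`-finite: every family of pairwise orthogonal non-zero projections is countable. -/
def IsSigmaFinite (M : VonNeumannAlgebra H) : Prop :=
  ∀ S : Set (Elt M), (∀ p ∈ S, IsStarProjection p ∧ p ≠ 0) →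
    S.Pairwise (fun p q => p * q = 0) → S.Countable

/-- A faithful normal semifinite trace on `M`. Only the values of `τ` on positive elements are
relevant. -/
structure IsFNSTrace (τ : Elt M → ℝ≥0∞) : Prop where
  add : ∀ x y : Elt M, 0 ≤ x → 0 ≤ y → τ (x + y) = τ x + τ y
  smul : ∀ (c : ℝ≥0) (x : Elt M), 0 ≤ x → τ (((c : ℝ) : ℂ) • x) = c * τ x
  trace : ∀ x : Elt M, τ (star x * x) = τ (x * star x)
  faithful : ∀ x : Elt M, 0 ≤ x → τ x = 0 → x = 0
  normal : ∀ (D : Set (Elt M)) (x : Elt M), D.Nonempty → DirectedOn (· ≤ ·) D →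
    (∀ d ∈ D, 0 ≤ d) → IsLUB D x → τ x = ⨆ d ∈ D, τ d
  semifinite : ∀ x : Elt M, 0 ≤ x → x ≠ 0 → ∃ y : Elt M, 0 ≤ y ∧ y ≤ x ∧ y ≠ 0 ∧ τ y < ∞

/-- `M` is semifinite: it carries a faithful normal semifinite trace. -/
def IsSemifinite (M : VonNeumannAlgebra H) : Prop :=
  ∃ τ : Elt M → ℝ≥0∞, IsFNSTrace τ

end Algebra

section Semigroup

variable {G : Type*} [Semigroup G] [MeasurableSpace G]

/-- The measure is invariant under both families of translations: `m(uB) = m(B) = m(Bu)`. -/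
def IsBiinvariant (m : MeasureTheory.Measure G) : Prop :=
  ∀ (u : G) (B : Set G), MeasurableSet B →
    m ((fun h => u * h) '' B) = m B ∧ m ((fun h => h * u) '' B) = m B

/-- A two-sided Følner net `(K i)` of measurable subsets of `G`. -/
structure IsFolnerNet {ι : Type*} [Preorder ι] (m : MeasureTheory.Measure G) (K : ι → Set G) :
    Prop where
  measurable : ∀ i, MeasurableSet (K i)
  pos : ∀ i, 0 < m (K i)
  finite : ∀ i, m (K i) < ∞
  right : ∀ g : G, Filter.Tendsto
    (fun i => m (symmDiff (K i) ((fun h => h * g) '' K i)) / m (K i)) Filter.atTop (nhds 0)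
  left : ∀ g : G, Filter.Tendsto
    (fun i => m (symmDiff (K i) ((fun h => g * h) '' K i)) / m (K i)) Filter.atTop (nhds 0)

end Semigroup

section Dynamics

variable {H : Type*} [NormedAddCommGroup H] [InnerProductSpace ℂ H] [CompleteSpace H]
variable {M : VonNeumannAlgebra H} {G : Type*} [Semigroup G]

/-- A non-commutative dynamical system `(M, G, α)`: an action or an anti-action of `G` on `M` by
normal positive subunital contractions, pointwise weak-* continuous in `g`. -/
structure IsDynamicalSystem [TopologicalSpace G] (α : G → (Elt M →L[ℂ] Elt M)) : Prop where
  action : (∀ (g h : G) (x : Elt M), α g (α h x) = α (g * h) x) ∨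
    (∀ (g h : G) (x : Elt M), α g (α h x) = α (h * g) x)
  normal : ∀ (g : G) (φ : Elt M →ₗ[ℂ] ℂ), IsNormal φ → IsNormal (φ ∘ₗ (α g : Elt M →ₗ[ℂ] Elt M))
  continuous : ∀ (x : Elt M) (φ : Elt M →ₗ[ℂ] ℂ), IsNormal φ → Continuous fun g => φ (α g x)
  contraction : ∀ g : G, ‖α g‖ ≤ 1
  positive : ∀ (g : G) (x : Elt M), 0 ≤ x → 0 ≤ α g x
  subunital : ∀ g : G, α g 1 ≤ 1

/-- `ρ` is a `G`-invariant normal state. -/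
def IsInvariantNormalState (α : G → (Elt M →L[ℂ] Elt M)) (ρ : Elt M →ₗ[ℂ] ℂ) : Prop :=
  IsNormalState ρ ∧ ∀ (g : G) (x : Elt M), ρ (α g x) = ρ x

/-- `y = (1 / m(K)) ∫_K α_g(x) dm(g)`, as a weak-* integral; `M_*` separates the points of `M`, so
there is at most one such `y`. -/
def IsAverage [MeasurableSpace G] (α : G → (Elt M →L[ℂ] Elt M)) (m : MeasureTheory.Measure G)
    (K : Set G) (x y : Elt M) : Prop :=
  ∀ φ : Elt M →ₗ[ℂ] ℂ, IsNormal φ →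
    φ y = ((m.real K)⁻¹ : ℝ) • ∫ g in K, φ (α g x) ∂m

/-- `x` is a weakly wandering operator: `x` is positive and the averages of `x` over the sets `K i`
tend to `0` in norm. -/
def IsWeaklyWandering [MeasurableSpace G] {ι : Type*} [Preorder ι]
    (α : G → (Elt M →L[ℂ] Elt M)) (m : MeasureTheory.Measure G) (K : ι → Set G) (x : Elt M) :
    Prop :=
  0 ≤ x ∧ ∃ A : ι → Elt M, (∀ i, IsAverage α m (K i) x (A i)) ∧
    Filter.Tendsto (fun i => ‖A i‖) Filter.atTop (nhds 0)

/-- `e₁ + e₂ = 1`, where `e₂` is the support of a weakly wandering operator and `e₁` is the support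
of a `G`-invariant normal state; when there is no such state at all, this means `e₁ = 0`. -/
structure IsNeveuDecomposition [MeasurableSpace G] {ι : Type*} [Preorder ι]
    (α : G → (Elt M →L[ℂ] Elt M)) (m : MeasureTheory.Measure G) (K : ι → Set G)
    (e₁ e₂ : Elt M) : Prop where
  isStarProjection_fst : IsStarProjection e₁
  isStarProjection_snd : IsStarProjection e₂
  add_eq_one : e₁ + e₂ = 1
  invariant : (∃ ρ, IsInvariantNormalState α ρ ∧ IsFunctionalSupport ρ e₁) ∨
    (e₁ = 0 ∧ ¬ ∃ ρ, IsInvariantNormalState α ρ)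
  wandering : ∃ x₀, IsWeaklyWandering α m K x₀ ∧ IsOperatorSupport x₀ e₂

end Dynamics

end Neveu

/-!
Fix an averaging family `A i` over the Følner sets; it absorbs every `α g` and every `A j`
asymptotically in norm. Let `y` be a positive operator annihilated by all invariant positive normal
functionals, and `φ` a normal positive functional with `φ y > 0`. If no `x ≤ y` with small loss
`φ (y - x)` had a small average, Hahn–Banach separation would give states `μ i` bounded below on
the averages `A i x` of these `x`. A limit point `ψ` of `μ i ∘ A i` is an invariant positive
functional. Splitting `ψ` into a normal and a singular part, the normal part is again invariant,
hence vanishes at `y`, while a singular functional is nearly killed by passing from `y` to some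
`x ≤ y` with small loss for `φ`: a contradiction. Iterating and taking a weak-* limit, there is a
nonzero weakly wandering operator below `y`.

By `σ`-finiteness there is a largest support `e₁` of an invariant positive normal functional and a
largest support `e₂` of a weakly wandering operator. They are orthogonal, since invariant normal
functionals vanish on weakly wandering operators, and the previous paragraph, applied to
`y = 1 - e₁ - e₂`, shows that they add up to `1`.
-/

namespace Neveu

open Filter MeasureTheory Topology

section VonNeumannAlgebra

variable {H : Type*} [NormedAddCommGroup H] [InnerProductSpace ℂ H] [CompleteSpace H]
variable {M : VonNeumannAlgebra H}

scoped instance isClosed_coe_toStarSubalgebra :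
    IsClosed (M.toStarSubalgebra : Set (H →L[ℂ] H)) := by
  rw [VonNeumannAlgebra.coe_toStarSubalgebra, ← VonNeumannAlgebra.centralizer_centralizer]
  exact Set.isClosed_centralizer _

theorem mem_of_forall_commutant {x : H →L[ℂ] H}
    (h : ∀ u ∈ M.commutant, u * x = x * u) : x ∈ M.toStarSubalgebra := by
  have hx : x ∈ M.commutant.commutant := VonNeumannAlgebra.mem_commutant_iff.2 h
  rwa [VonNeumannAlgebra.commutant_commutant] at hx

theorem commutant_comm {u : H →L[ℂ] H} (hu : u ∈ M.commutant) (x : Elt M) :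
    (x : H →L[ℂ] H) * u = u * (x : H →L[ℂ] H) :=
  VonNeumannAlgebra.mem_commutant_iff.1 hu x x.2

theorem sqrt_mem (x : Elt M) : CFC.sqrt (x : H →L[ℂ] H) ∈ M.toStarSubalgebra :=
  mem_of_forall_commutant fun _ hu =>
    (Commute.cfcₙ_nnreal (commutant_comm hu x) NNReal.sqrt).eq.symm

scoped instance : StarOrderedRing (Elt M) :=
  StarOrderedRing.of_nonneg_iff' (fun {_ _} h z => add_le_add_right h z) fun x => by
    constructor
    · intro hx
      have hsa : IsSelfAdjoint (CFC.sqrt (x : H →L[ℂ] H)) := (CFC.sqrt_nonneg _).isSelfAdjoint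
      refine ⟨⟨_, sqrt_mem x⟩, Subtype.ext ?_⟩
      change (x : H →L[ℂ] H) = star (CFC.sqrt (x : H →L[ℂ] H)) * CFC.sqrt (x : H →L[ℂ] H)
      rw [hsa.star_eq, CFC.sqrt_mul_sqrt_self (x : H →L[ℂ] H) hx]
    · rintro ⟨s, rfl⟩
      exact star_mul_self_nonneg (s : H →L[ℂ] H)

end VonNeumannAlgebra

section Amplification

variable {F : Type*} [NormedAddCommGroup F] [InnerProductSpace ℂ F] [CompleteSpace F]

/-- The amplification of the bounded operators on `F`: the diagonal operators `T ⊕ T ⊕ ⋯` on the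
Hilbert sum of copies of `F` indexed by `κ`. -/
noncomputable def amplification (κ : Type*) :
    (F →L[ℂ] F) →⋆ₐ[ℂ] (lp (fun _ : κ => F) 2 →L[ℂ] lp (fun _ : κ => F) 2) where
  toFun T := lp.mapCLM 2 (fun _ => T) (norm_nonneg T) (fun _ => le_rfl)
  map_one' := by ext; simp
  map_mul' S T := by ext; simp
  map_zero' := by ext; simp
  map_add' S T := by ext; simp
  commutes' c := by ext; simp [Algebra.algebraMap_eq_smul_one]
  map_star' T := by
    refine (ContinuousLinearMap.eq_adjoint_iff _ _).2 fun v w => ?_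
    simp only [lp.inner_eq_tsum, lp.mapCLM_apply_coe, ContinuousLinearMap.star_eq_adjoint,
      ContinuousLinearMap.adjoint_inner_left]

@[simp]
theorem amplification_apply {κ : Type*} (T : F →L[ℂ] F) (v : lp (fun _ : κ => F) 2) (n : κ) :
    amplification (F := F) κ T v n = T (v n) := by
  simp [amplification]

end Amplification

section Representations

variable {A : Type*} [CStarAlgebra A]
variable {E F : Type*} [NormedAddCommGroup E] [InnerProductSpace ℂ E] [CompleteSpace E]
  [NormedAddCommGroup F] [InnerProductSpace ℂ F] [CompleteSpace F]
  (σ : A →⋆ₐ[ℂ] (E →L[ℂ] E)) (π : A →⋆ₐ[ℂ] (F →L[ℂ] F))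

theorem rep_inner_left (x : A) (u v : F) : inner ℂ (π x u) v = inner ℂ u (π (star x) v) := by
  rw [map_star, ContinuousLinearMap.star_eq_adjoint, ContinuousLinearMap.adjoint_inner_right]

theorem rep_mul_apply (x y : A) (v : F) : π (x * y) v = π x (π y v) := by
  rw [map_mul]; rfl

theorem rep_one_apply (v : F) : π 1 v = v := by
  rw [map_one]; rfl

theorem rep_norm_sq (x : A) (v : F) : (‖π x v‖ ^ 2 : ℂ) = inner ℂ v (π (star x * x) v) := by
  rw [rep_mul_apply, ← rep_inner_left]
  exact (inner_self_eq_norm_sq_to_K (𝕜 := ℂ) (π x v)).symm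

theorem norm_rep_apply_le (x : A) (v : F) : ‖π x v‖ ≤ ‖x‖ * ‖v‖ :=
  (π x).le_of_opNorm_le (NonUnitalStarAlgHom.norm_apply_le π x) v

/-- The orbit map `x ↦ π x v` of a vector `v`. -/
noncomputable def orbitMap (v : F) : A →ₗ[ℂ] F where
  toFun x := π x v
  map_add' x y := by simp
  map_smul' c x := by simp

@[simp]
theorem orbitMap_apply (v : F) (x : A) : orbitMap π v x = π x v := rfl

/-- The closed cyclic subspace generated by `v`. -/
noncomputable def cyclicSubspace (v : F) : Submodule ℂ F :=
  (LinearMap.range (orbitMap π v)).topologicalClosure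

instance (v : F) : CompleteSpace (cyclicSubspace π v) :=
  (Submodule.isClosed_topologicalClosure _).completeSpace_coe

theorem rep_mem_cyclicSubspace (v : F) (x : A) : π x v ∈ cyclicSubspace π v :=
  Submodule.le_topologicalClosure _ ⟨x, rfl⟩

theorem self_mem_cyclicSubspace (v : F) : v ∈ cyclicSubspace π v := by
  simpa only [rep_one_apply] using rep_mem_cyclicSubspace π v 1

theorem rep_mem_cyclicSubspace_of_mem {v w : F} (hw : w ∈ cyclicSubspace π v) (x : A) :
    π x w ∈ cyclicSubspace π v := by
  have h : Set.MapsTo (π x) (LinearMap.range (orbitMap π v) : Set F)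
      (LinearMap.range (orbitMap π v) : Set F) := by
    rintro _ ⟨y, rfl⟩
    exact ⟨x * y, by simp⟩
  exact h.closure (π x).continuous hw

/-- The orbit map of `v`, with values in the cyclic subspace that `v` generates. -/
noncomputable def cyclicMap (v : F) : A →ₗ[ℂ] cyclicSubspace π v :=
  (orbitMap π v).codRestrict _ (rep_mem_cyclicSubspace π v)

theorem denseRange_cyclicMap (v : F) : DenseRange (cyclicMap π v) := by
  intro w
  rw [closure_subtype, ← Set.range_comp]
  exact w.2

theorem starProjection_rep {W : Submodule ℂ F} [W.HasOrthogonalProjection]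
    (hW : ∀ x, ∀ w ∈ W, π x w ∈ W) (x : A) (v : F) :
    W.starProjection (π x v) = π x (W.starProjection v) := by
  refine Submodule.eq_starProjection_of_mem_of_inner_eq_zero
    (hW x _ (Submodule.starProjection_apply_mem W v)) fun w hw => ?_
  rw [← map_sub, rep_inner_left]
  exact Submodule.starProjection_inner_eq_zero v _ (hW _ _ hw)

theorem exists_intertwiner {ζ : E} {κ : F} (h : ∀ x, ‖π x κ‖ ≤ ‖σ x ζ‖) :
    ∃ V : E →L[ℂ] F, V ζ = κ ∧ ∀ x v, V (σ x v) = π x (V v) := by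
  let W := cyclicSubspace σ ζ
  let e : A →ₗ[ℂ] W := cyclicMap σ ζ
  have he : DenseRange e := denseRange_cyclicMap σ ζ
  let V₀ : W →L[ℂ] F := (orbitMap π κ).extendOfNorm e
  have hV₀ (x : A) : V₀ (e x) = π x κ :=
    LinearMap.extendOfNorm_eq he ⟨1, fun x => by rw [one_mul]; exact h x⟩ x
  have hV₀_comm (x : A) (w : W) :
      V₀ ⟨σ x w, rep_mem_cyclicSubspace_of_mem σ w.2 x⟩ = π x (V₀ w) := by
    refine he.induction_on (p := fun w : W =>
      V₀ ⟨σ x w, rep_mem_cyclicSubspace_of_mem σ w.2 x⟩ = π x (V₀ w)) w ?_ fun a => ?_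
    · exact isClosed_eq (V₀.continuous.comp (Continuous.subtype_mk (by fun_prop) _))
        (by fun_prop)
    · rw [hV₀, ← rep_mul_apply, ← hV₀]
      exact congrArg V₀ (Subtype.ext (rep_mul_apply σ x a ζ).symm)
  refine ⟨V₀ ∘L W.orthogonalProjectionOnto, ?_, fun x v => ?_⟩
  · have hζ : W.orthogonalProjectionOnto ζ = e 1 := Subtype.ext <|
      (Submodule.starProjection_eq_self_iff.2 (self_mem_cyclicSubspace σ ζ)).trans
        (rep_one_apply σ ζ).symm
    rw [ContinuousLinearMap.comp_apply, hζ, hV₀, rep_one_apply]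
  · rw [ContinuousLinearMap.comp_apply, ContinuousLinearMap.comp_apply, ← hV₀_comm]
    exact congrArg V₀ (Subtype.ext
      (starProjection_rep σ (fun x _ hw => rep_mem_cyclicSubspace_of_mem σ hw x) x v))

theorem norm_sqrt_adjoint_comp_self_apply (V : E →L[ℂ] F) (v : E) :
    ‖CFC.sqrt (V.adjoint ∘L V) v‖ = ‖V v‖ := by
  have hpos : 0 ≤ V.adjoint ∘L V := by
    rw [ContinuousLinearMap.nonneg_iff_isPositive]
    exact ContinuousLinearMap.isPositive_adjoint_comp_self V
  have hsa : IsSelfAdjoint (CFC.sqrt (V.adjoint ∘L V)) := (CFC.sqrt_nonneg _).isSelfAdjoint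
  have hsq : CFC.sqrt (V.adjoint ∘L V) (CFC.sqrt (V.adjoint ∘L V) v) = V.adjoint (V v) :=
    congrArg (fun S : E →L[ℂ] E => S v) (CFC.sqrt_mul_sqrt_self _ hpos)
  have hinner : inner ℂ (CFC.sqrt (V.adjoint ∘L V) v) (CFC.sqrt (V.adjoint ∘L V) v) =
      inner ℂ (V v) (V v) := by
    rw [← ContinuousLinearMap.adjoint_inner_right, ← ContinuousLinearMap.star_eq_adjoint,
      hsa.star_eq, hsq, ContinuousLinearMap.adjoint_inner_right]
  rw [inner_self_eq_norm_sq_to_K, inner_self_eq_norm_sq_to_K] at hinner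
  exact (sq_eq_sq₀ (norm_nonneg _) (norm_nonneg _)).1 (by exact_mod_cast hinner)

theorem exists_norm_rep_eq {ζ : E} {κ : F} (h : ∀ x, ‖π x κ‖ ≤ ‖σ x ζ‖) :
    ∃ ζ' : E, ∀ x, ‖π x κ‖ = ‖σ x ζ'‖ := by
  obtain ⟨V, hVζ, hV⟩ := exists_intertwiner σ π h
  have hV_adjoint (x : A) (v : F) : V.adjoint (π x v) = σ x (V.adjoint v) := by
    refine ext_inner_right ℂ fun w => ?_
    rw [ContinuousLinearMap.adjoint_inner_left, rep_inner_left, rep_inner_left, ← hV,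
      ContinuousLinearMap.adjoint_inner_left]
  have hcomm (x : A) : Commute (V.adjoint ∘L V) (σ x) := by
    ext v
    simp [hV, hV_adjoint]
  have hsqrt (x : A) (v : E) :
      CFC.sqrt (V.adjoint ∘L V) (σ x v) = σ x (CFC.sqrt (V.adjoint ∘L V) v) :=
    congrArg (fun S : E →L[ℂ] E => S v) ((hcomm x).cfcₙ_nnreal NNReal.sqrt).eq
  refine ⟨CFC.sqrt (V.adjoint ∘L V) ζ, fun x => ?_⟩
  rw [← hVζ, ← hV, ← hsqrt, norm_sqrt_adjoint_comp_self_apply]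

/-- A representation is ample if square-summable sequences of vectors can be merged into one vector,
as in an infinite amplification. -/
def IsAmple : Prop :=
  ∀ ζ : ℕ → E, Summable (fun j => ‖ζ j‖ ^ 2) →
    ∃ ζ' : E, ∀ x, HasSum (fun j => ‖σ x (ζ j)‖ ^ 2) (‖σ x ζ'‖ ^ 2)

variable {σ}

theorem IsAmple.exists_forall_norm_le (hσ : IsAmple σ) {ζ : ℕ → E}
    (hζ : Summable fun j => ‖ζ j‖ ^ 2) : ∃ ζ' : E, ∀ x j, ‖σ x (ζ j)‖ ≤ ‖σ x ζ'‖ := by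
  obtain ⟨ζ', h⟩ := hσ ζ hζ
  exact ⟨ζ', fun x j => (sq_le_sq₀ (norm_nonneg _) (norm_nonneg _)).1
    (le_hasSum (h x) j fun _ _ => sq_nonneg _)⟩

theorem IsAmple.exists_norm_le (hσ : IsAmple σ) (ζ₁ ζ₂ : E) :
    ∃ ζ : E, ∀ x, ‖σ x ζ₁‖ ≤ ‖σ x ζ‖ ∧ ‖σ x ζ₂‖ ≤ ‖σ x ζ‖ := by
  let ζ : ℕ → E := fun j => if j = 0 then ζ₁ else if j = 1 then ζ₂ else 0
  have hζ : Summable fun j => ‖ζ j‖ ^ 2 := by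
    refine summable_of_ne_finset_zero (s := Finset.range 2) fun j hj => ?_
    have hj : 2 ≤ j := by simpa only [Finset.mem_range, not_lt] using hj
    simp [ζ, show j ≠ 0 by omega, show j ≠ 1 by omega]
  obtain ⟨Z, hZ⟩ := hσ.exists_forall_norm_le hζ
  exact ⟨Z, fun x => ⟨by simpa only [ζ, if_pos] using hZ x 0, by simpa [ζ] using hZ x 1⟩⟩

theorem lp_hasSum_norm_sq {V : Type*} [NormedAddCommGroup V] (v : lp (fun _ : ℕ => V) 2) :
    HasSum (fun n => ‖v n‖ ^ 2) (‖v‖ ^ 2) := by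
  simpa using lp.hasSum_norm (p := 2) (by norm_num) v

theorem isAmple_amplification (τ : A →⋆ₐ[ℂ] (F →L[ℂ] F)) :
    IsAmple ((amplification ℕ).comp τ) := by
  intro ζ hζ
  have hsum : Summable fun p : ℕ × ℕ => ‖ζ p.1 p.2‖ ^ 2 := by
    rw [summable_prod_of_nonneg fun _ => by positivity]
    exact ⟨fun j => (lp_hasSum_norm_sq (ζ j)).summable, by
      simpa only [(lp_hasSum_norm_sq _).tsum_eq] using hζ⟩
  let e : ℕ ≃ ℕ × ℕ := Nat.pairEquiv.symm
  have hmem : Memℓp (fun n => ζ (e n).1 (e n).2) 2 := by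
    rw [memℓp_gen_iff (by norm_num)]
    simpa [Function.comp_def] using e.summable_iff.2 hsum
  refine ⟨⟨_, hmem⟩, fun x => ?_⟩
  have hpairs : HasSum (fun p : ℕ × ℕ => ‖τ x (ζ p.1 p.2)‖ ^ 2)
      (‖(amplification ℕ).comp τ x ⟨_, hmem⟩‖ ^ 2) := by
    rw [← e.hasSum_iff]
    simpa [Function.comp_def] using lp_hasSum_norm_sq ((amplification ℕ).comp τ x ⟨_, hmem⟩)
  refine hpairs.prod_fiberwise fun j => ?_
  simpa using lp_hasSum_norm_sq ((amplification ℕ).comp τ x (ζ j))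

end Representations

section Dominated

variable {A : Type*} [CStarAlgebra A]
variable {E F : Type*} [NormedAddCommGroup E] [InnerProductSpace ℂ E] [CompleteSpace E]
  [NormedAddCommGroup F] [InnerProductSpace ℂ F] [CompleteSpace F]
  {σ : A →⋆ₐ[ℂ] (E →L[ℂ] E)} (hσ : IsAmple σ) (π : A →⋆ₐ[ℂ] (F →L[ℂ] F))

theorem norm_rep_smul {c : ℝ} (hc : 0 ≤ c) (x : A) (v : F) :
    ‖π x ((c : ℂ) • v)‖ = c * ‖π x v‖ := by
  rw [map_smul, norm_smul, Complex.norm_real, Real.norm_of_nonneg hc]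

theorem exists_dominating_of_le {κ : F} {ζ : E} {c : ℝ} (hc : 0 ≤ c)
    (h : ∀ x, ‖π x κ‖ ≤ c * ‖σ x ζ‖) : ∃ ζ' : E, ∀ x, ‖π x κ‖ ≤ ‖σ x ζ'‖ :=
  ⟨(c : ℂ) • ζ, fun x => by rw [norm_rep_smul σ hc]; exact h x⟩

/-- The vectors of a representation `π` whose orbit is dominated in norm by the orbit of a vector of
the ample representation `σ`. For the standard representation `σ` of a von Neumann algebra they are
the vectors that define a normal functional. -/
def dominatedSubmodule : Submodule ℂ F where
  carrier := {κ | ∃ ζ : E, ∀ x, ‖π x κ‖ ≤ ‖σ x ζ‖}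
  zero_mem' := ⟨0, fun x => by simp⟩
  add_mem' := by
    rintro κ₁ κ₂ ⟨ζ₁, h₁⟩ ⟨ζ₂, h₂⟩
    obtain ⟨ζ, hζ⟩ := hσ.exists_norm_le ζ₁ ζ₂
    refine exists_dominating_of_le π (ζ := ζ) zero_le_two fun x => ?_
    rw [map_add]
    linarith [norm_add_le (π x κ₁) (π x κ₂), (h₁ x).trans (hζ x).1, (h₂ x).trans (hζ x).2]
  smul_mem' := by
    rintro c κ ⟨ζ, h⟩
    refine exists_dominating_of_le π (ζ := ζ) (norm_nonneg c) fun x => ?_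
    rw [map_smul, norm_smul]
    exact mul_le_mul_of_nonneg_left (h x) (norm_nonneg c)

theorem rep_mem_dominatedSubmodule (a : A) {κ : F} (hκ : κ ∈ dominatedSubmodule hσ π) :
    π a κ ∈ dominatedSubmodule hσ π := by
  obtain ⟨ζ, h⟩ := hκ
  refine ⟨σ a ζ, fun x => ?_⟩
  rw [← rep_mul_apply, ← rep_mul_apply]
  exact h _

theorem exists_dominating_geometric {v : ℕ → F} (hv : ∀ j, v j ∈ dominatedSubmodule hσ π)
    (hv_norm : ∀ j, 0 < j → ‖v j‖ < (1 / 4) ^ j) :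
    ∃ Z : E, ∀ x j, ‖π x (v j)‖ ≤ (1 / 2) ^ j * ‖σ x Z‖ := by
  have hex (j : ℕ) : ∃ ζ : E, ∀ x, ‖π x (v j)‖ = ‖σ x ζ‖ := by
    obtain ⟨ζ, h⟩ := hv j
    exact exists_norm_rep_eq σ π h
  choose ζ hζ using hex
  have hζ_norm (j : ℕ) : ‖ζ j‖ = ‖v j‖ := by
    simpa only [rep_one_apply] using (hζ j 1).symm
  have hsum : Summable fun j => ‖((2 ^ j : ℝ) : ℂ) • ζ j‖ ^ 2 := by
    rw [← summable_nat_add_iff 1]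
    refine Summable.of_nonneg_of_le (fun j => by positivity) (fun j => ?_)
      ((summable_nat_add_iff 1).2 (summable_geometric_of_lt_one (r := (1 / 4 : ℝ)) (by norm_num)
        (by norm_num)))
    rw [norm_smul, Complex.norm_real, Real.norm_of_nonneg (by positivity), hζ_norm]
    calc (2 ^ (j + 1) * ‖v (j + 1)‖) ^ 2
        ≤ (2 ^ (j + 1) * (1 / 4) ^ (j + 1)) ^ 2 := by
          gcongr
          exact (hv_norm _ j.succ_pos).le
      _ = (1 / 4) ^ (j + 1) := by rw [← mul_pow, pow_right_comm]; norm_num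
  obtain ⟨Z, hZ⟩ := hσ.exists_forall_norm_le hsum
  refine ⟨Z, fun x j => ?_⟩
  have h := hZ x j
  rw [norm_rep_smul σ (by positivity)] at h
  calc ‖π x (v j)‖ = (1 / 2) ^ j * (2 ^ j * ‖σ x (ζ j)‖) := by
        rw [hζ, ← mul_assoc, ← mul_pow]; norm_num
    _ ≤ (1 / 2) ^ j * ‖σ x Z‖ := by gcongr

theorem isClosed_dominatedSubmodule : IsClosed (dominatedSubmodule hσ π : Set F) := by
  refine isClosed_of_closure_subset fun κ hκ => ?_
  obtain ⟨v, hlim, hv, -, hv_norm⟩ := controlled_sum_of_mem_closure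
    (s := (dominatedSubmodule hσ π).toAddSubgroup) hκ (b := fun j => (1 / 4) ^ j)
    fun j => by positivity
  obtain ⟨Z, hZ⟩ := exists_dominating_geometric hσ π hv hv_norm
  refine exists_dominating_of_le π (ζ := Z) zero_le_two fun x => ?_
  have hgeom (n : ℕ) : ∑ j ∈ Finset.range n, (1 / 2 : ℝ) ^ j ≤ 2 :=
    sum_le_hasSum _ (fun j _ => by positivity) hasSum_geometric_two
  refine le_of_tendsto' (((π x).continuous.tendsto κ).comp hlim).norm fun n => ?_
  calc ‖π x (∑ j ∈ Finset.range (n + 1), v j)‖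
      ≤ ∑ j ∈ Finset.range (n + 1), ‖π x (v j)‖ := by
        rw [map_sum]; exact norm_sum_le _ _
    _ ≤ ∑ j ∈ Finset.range (n + 1), (1 / 2) ^ j * ‖σ x Z‖ :=
        Finset.sum_le_sum fun j _ => hZ x j
    _ ≤ 2 * ‖σ x Z‖ := by
        rw [← Finset.sum_mul]
        exact mul_le_mul_of_nonneg_right (hgeom _) (norm_nonneg _)

instance : CompleteSpace (dominatedSubmodule hσ π) :=
  (isClosed_dominatedSubmodule hσ π).completeSpace_coe

theorem rep_mem_dominatedSubmodule_orthogonal (a : A) {η : F}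
    (hη : η ∈ (dominatedSubmodule hσ π)ᗮ) : π a η ∈ (dominatedSubmodule hσ π)ᗮ := by
  rw [Submodule.mem_orthogonal'] at hη ⊢
  intro u hu
  rw [rep_inner_left]
  exact hη _ (rep_mem_dominatedSubmodule hσ π _ hu)

end Dominated

section ApproximateUnits

variable {A : Type*} [CStarAlgebra A]
variable {E F : Type*} [NormedAddCommGroup E] [InnerProductSpace ℂ E] [CompleteSpace E]
  [NormedAddCommGroup F] [InnerProductSpace ℂ F] [CompleteSpace F]

/-- The direct sum of two representations, on the Hilbert sum of the two spaces. -/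
noncomputable def prodRep (σ : A →⋆ₐ[ℂ] (E →L[ℂ] E)) (π : A →⋆ₐ[ℂ] (F →L[ℂ] F)) :
    A →⋆ₐ[ℂ] (WithLp 2 (E × F) →L[ℂ] WithLp 2 (E × F)) where
  toFun x := (WithLp.prodContinuousLinearEquiv 2 ℂ E F).symm.toContinuousLinearMap ∘L
    ((σ x).prodMap (π x)) ∘L (WithLp.prodContinuousLinearEquiv 2 ℂ E F).toContinuousLinearMap
  map_one' := by
    refine ContinuousLinearMap.ext fun v => WithLp.ofLp_injective 2 (Prod.ext ?_ ?_) <;>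
      simp
  map_mul' x y := by
    refine ContinuousLinearMap.ext fun v => WithLp.ofLp_injective 2 (Prod.ext ?_ ?_) <;>
      simp
  map_zero' := by
    refine ContinuousLinearMap.ext fun v => WithLp.ofLp_injective 2 (Prod.ext ?_ ?_) <;>
      simp
  map_add' x y := by
    refine ContinuousLinearMap.ext fun v => WithLp.ofLp_injective 2 (Prod.ext ?_ ?_) <;>
      simp
  commutes' c := by
    refine ContinuousLinearMap.ext fun v => WithLp.ofLp_injective 2 (Prod.ext ?_ ?_) <;>
      simp [Algebra.algebraMap_eq_smul_one]
  map_star' x := by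
    refine (ContinuousLinearMap.eq_adjoint_iff _ _).2 fun v w => ?_
    simp only [WithLp.prod_inner_apply]
    exact congrArg₂ (· + ·) (by simpa using rep_inner_left σ (star x) v.fst w.fst)
      (by simpa using rep_inner_left π (star x) v.snd w.snd)

@[simp]
theorem prodRep_apply_snd (σ : A →⋆ₐ[ℂ] (E →L[ℂ] E)) (π : A →⋆ₐ[ℂ] (F →L[ℂ] F)) (x : A)
    (v : WithLp 2 (E × F)) : (prodRep σ π x v).snd = π x v.snd := rfl

variable {σ : A →⋆ₐ[ℂ] (E →L[ℂ] E)} (hσ : IsAmple σ) (π : A →⋆ₐ[ℂ] (F →L[ℂ] F))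

theorem snd_starProjection_mem_dominatedSubmodule {R : Submodule ℂ (WithLp 2 (E × F))}
    [R.HasOrthogonalProjection] (hR : ∀ x, ∀ v ∈ R, prodRep σ π x v ∈ R) (ζ : E) :
    (R.starProjection (WithLp.toLp 2 (ζ, 0))).snd ∈ dominatedSubmodule hσ π := by
  refine ⟨ζ, fun x => ?_⟩
  have hx : prodRep σ π x (WithLp.toLp 2 (ζ, 0)) = WithLp.toLp 2 (σ x ζ, 0) :=
    WithLp.ofLp_injective 2 (Prod.ext rfl (map_zero (π x)))
  calc ‖π x (R.starProjection (WithLp.toLp 2 (ζ, 0))).snd‖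
      = ‖(R.starProjection (WithLp.toLp 2 (σ x ζ, 0))).snd‖ := by
        rw [← prodRep_apply_snd σ π, ← starProjection_rep _ hR, hx]
    _ ≤ ‖R.starProjection (WithLp.toLp 2 (σ x ζ, 0))‖ := WithLp.norm_snd_le _ _
    _ ≤ ‖WithLp.toLp 2 (σ x ζ, (0 : F))‖ := R.norm_starProjection_apply_le _
    _ = ‖σ x ζ‖ := WithLp.norm_toLp_fst 2 E F _

theorem toLp_zero_mem_cyclicSubspace (ζ : E) {η : F} (hη : η ∈ (dominatedSubmodule hσ π)ᗮ) :
    WithLp.toLp 2 (ζ, (0 : F)) ∈ cyclicSubspace (prodRep σ π) (WithLp.toLp 2 (ζ, η)) := by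
  let w : WithLp 2 (E × F) := WithLp.toLp 2 (ζ, η)
  let p : WithLp 2 (E × F) := WithLp.toLp 2 (ζ, 0)
  let q : WithLp 2 (E × F) := (cyclicSubspace (prodRep σ π) w).starProjection p
  have hq : q.snd ∈ dominatedSubmodule hσ π := snd_starProjection_mem_dominatedSubmodule hσ π
    (fun x _ hv => rep_mem_cyclicSubspace_of_mem _ hv x) ζ
  have horth : inner ℂ (p - q) w = 0 :=
    Submodule.starProjection_inner_eq_zero p w (self_mem_cyclicSubspace _ w)
  have hp : inner ℂ (p - q) p = 0 := by
    have hsnd : inner ℂ (p - q).snd η = 0 := by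
      rw [show (p - q).snd = -q.snd from zero_sub _, inner_neg_left,
        (Submodule.mem_orthogonal _ _).1 hη _ hq, neg_zero]
    rw [WithLp.prod_inner_apply] at horth ⊢
    change inner ℂ (p - q).fst ζ + inner ℂ (p - q).snd η = 0 at horth
    change inner ℂ (p - q).fst ζ + inner ℂ (p - q).snd 0 = 0
    rw [inner_zero_right]
    rwa [hsnd] at horth
  have hpq : p - q = 0 := by
    rw [← inner_self_eq_zero (𝕜 := ℂ), inner_sub_right, hp,
      Submodule.starProjection_inner_eq_zero p q (Submodule.starProjection_apply_mem _ p), sub_zero]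
  exact Submodule.starProjection_eq_self_iff.1 (sub_eq_zero.1 hpq).symm

/-- The map `x ↦ (σ (x⋆) ζ, π x η)`; it is linear over the reals only. -/
noncomputable def starOrbitMap (σ : A →⋆ₐ[ℂ] (E →L[ℂ] E)) (π : A →⋆ₐ[ℂ] (F →L[ℂ] F)) (ζ : E)
    (η : F) : A →ₗ[ℝ] WithLp 2 (E × F) where
  toFun x := WithLp.toLp 2 (σ (star x) ζ, π x η)
  map_add' x y := WithLp.ofLp_injective 2 (by simp)
  map_smul' c x := WithLp.ofLp_injective 2 (by simp [← Complex.coe_smul])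

theorem toLp_zero_mem_closure_range_starOrbitMap (ζ : E) {η : F}
    (hη : η ∈ (dominatedSubmodule hσ π)ᗮ) :
    WithLp.toLp 2 (ζ, (0 : F)) ∈ closure (Set.range (starOrbitMap σ π ζ η)) := by
  let _ := InnerProductSpace.rclikeToReal ℂ (WithLp 2 (E × F))
  change _ ∈ (LinearMap.range (starOrbitMap σ π ζ η)).topologicalClosure
  rw [← Submodule.orthogonal_orthogonal_eq_closure, Submodule.mem_orthogonal]
  intro w hw
  have hre (x : A) : (inner ℂ ζ (σ x w.fst) + inner ℂ w.snd (π x η)).re = 0 := by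
    have h : (inner ℂ (starOrbitMap σ π ζ η x) w).re = 0 :=
      (Submodule.mem_orthogonal _ _).1 hw _ ⟨x, rfl⟩
    rw [WithLp.prod_inner_apply] at h
    change (inner ℂ (σ (star x) ζ) w.fst + inner ℂ (π x η) w.snd).re = 0 at h
    rwa [rep_inner_left, star_star, Complex.add_re, ← inner_conj_symm (π x η), Complex.conj_re,
      ← Complex.add_re] at h
  have horbit (x : A) : inner ℂ ζ (σ x w.fst) + inner ℂ w.snd (π x η) = 0 := by
    refine Complex.ext (hre x) ?_
    have h := hre (Complex.I • x)
    simp only [map_smul, smul_apply, inner_smul_right, ← mul_add] at h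
    simpa [← neg_add_rev] using h
  have hzero : inner ℂ (WithLp.toLp 2 (ζ, w.snd)) (WithLp.toLp 2 (w.fst, (0 : F))) = 0 := by
    have hclosed : IsClosed {v | inner ℂ (WithLp.toLp 2 (ζ, w.snd)) v = 0} :=
      isClosed_eq (by fun_prop) continuous_const
    refine closure_minimal ?_ hclosed (toLp_zero_mem_cyclicSubspace hσ π w.fst hη)
    rintro _ ⟨x, rfl⟩
    exact horbit x
  have hfst : inner ℂ ζ w.fst = 0 := by
    simpa [WithLp.prod_inner_apply] using hzero
  change (inner ℂ w (WithLp.toLp 2 (ζ, (0 : F)))).re = 0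
  rw [WithLp.prod_inner_apply]
  simp [inner_eq_zero_symm.1 hfst]

theorem exists_rep_near_one_near_zero (ζ : E) {η : F} (hη : η ∈ (dominatedSubmodule hσ π)ᗮ)
    {ε : ℝ} (hε : 0 < ε) : ∃ x : A, ‖σ (star x) ζ - ζ‖ < ε ∧ ‖π x η‖ < ε := by
  obtain ⟨_, ⟨x, rfl⟩, hx⟩ := Metric.mem_closure_iff.1
    (toLp_zero_mem_closure_range_starOrbitMap hσ π ζ hη) ε hε
  rw [dist_comm, dist_eq_norm] at hx
  refine ⟨x, (WithLp.norm_fst_le _ _).trans_lt hx, ?_⟩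
  have h : ‖π x η - 0‖ < ε := (WithLp.norm_snd_le _ _).trans_lt hx
  rwa [sub_zero] at h

theorem norm_rep_apply_le_of_isSelfAdjoint {k : A} (hk : IsSelfAdjoint k) (x : A) (v : F) :
    ‖π k v‖ ≤ ‖x * k‖ * ‖v‖ + ‖k‖ * ‖π (star x) v - v‖ := by
  have hsplit : π k v = π (k * star x) v - π k (π (star x) v - v) := by
    rw [map_sub, rep_mul_apply, sub_sub_cancel]
  have hadj : ‖k * star x‖ = ‖x * k‖ := by
    rw [← norm_star, star_mul, star_star, hk.star_eq]
  calc ‖π k v‖ ≤ ‖π (k * star x) v‖ + ‖π k (π (star x) v - v)‖ := by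
        rw [hsplit]
        exact norm_sub_le _ _
    _ ≤ ‖x * k‖ * ‖v‖ + ‖k‖ * ‖π (star x) v - v‖ := by
        rw [← hadj]
        exact add_le_add (norm_rep_apply_le π _ v) (norm_rep_apply_le π k _)

end ApproximateUnits

section Effects

variable {A : Type*} [CStarAlgebra A] [PartialOrder A] [StarOrderedRing A]
variable {E F : Type*} [NormedAddCommGroup E] [InnerProductSpace ℂ E] [CompleteSpace E]
  [NormedAddCommGroup F] [InnerProductSpace ℂ F] [CompleteSpace F]
  {σ : A →⋆ₐ[ℂ] (E →L[ℂ] E)} (hσ : IsAmple σ) (π : A →⋆ₐ[ℂ] (F →L[ℂ] F))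

theorem inner_rep_nonneg {a : A} (ha : 0 ≤ a) (v : F) : 0 ≤ inner ℂ v (π a v) := by
  obtain ⟨s, rfl⟩ := CStarAlgebra.nonneg_iff_eq_star_mul_self.1 ha
  rw [← rep_norm_sq]
  exact_mod_cast sq_nonneg ‖π s v‖

theorem inner_rep_mono {a b : A} (hab : a ≤ b) (v : F) :
    inner ℂ v (π a v) ≤ inner ℂ v (π b v) := by
  have h := inner_rep_nonneg π (sub_nonneg.2 hab) v
  rwa [map_sub, sub_apply, inner_sub_right, sub_nonneg] at h

/-- The witness is `k = (1 + x⋆x)^{-1/2}`. -/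
theorem exists_isSelfAdjoint_norm_mul_le_one (x : A) :
    ∃ k : A, IsSelfAdjoint k ∧ ‖k‖ ≤ 1 ∧ ‖x * k‖ ≤ 1 ∧ k * k ≤ 1 ∧ 1 - k * k ≤ star x * x := by
  let φ : ℝ → ℝ := fun t => (√(1 + |t|))⁻¹
  have hφ : Continuous φ := Continuous.inv₀ (by fun_prop) fun t => by positivity
  have hφ_nonneg (t : ℝ) : 0 ≤ φ t := by positivity
  have hφ_sq (t : ℝ) : φ t * φ t = (1 + |t|)⁻¹ := by
    rw [← mul_inv, Real.mul_self_sqrt (by positivity)]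
  have hφ_sq_le (t : ℝ) : φ t * φ t ≤ 1 := by
    rw [hφ_sq]
    exact inv_le_one_of_one_le₀ (le_add_of_nonneg_right (abs_nonneg t))
  clear_value φ
  have hsa : IsSelfAdjoint (star x * x) := .star_mul_self x
  have hspec : ∀ t ∈ spectrum ℝ (star x * x), 0 ≤ t :=
    fun t ht => spectrum_nonneg_of_nonneg (star_mul_self_nonneg x) ht
  have hkk : cfc φ (star x * x) * cfc φ (star x * x) = cfc (fun t => φ t * φ t) (star x * x) :=
    (cfc_mul φ φ _ hφ.continuousOn hφ.continuousOn).symm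
  refine ⟨cfc φ (star x * x), cfc_predicate _ _, norm_cfc_le zero_le_one fun t _ => ?_, ?_, ?_, ?_⟩
  · rw [Real.norm_of_nonneg (hφ_nonneg t)]
    nlinarith [hφ_sq_le t, hφ_nonneg t]
  · have hsq : star (x * cfc φ (star x * x)) * (x * cfc φ (star x * x)) =
        cfc (fun t => φ t * (t * φ t)) (star x * x) := by
      rw [cfc_mul φ (fun t => t * φ t) _ hφ.continuousOn (by fun_prop),
        cfc_mul (fun t => t) φ _ (by fun_prop) hφ.continuousOn, cfc_id' ℝ (star x * x), star_mul,
        IsSelfAdjoint.star_eq (cfc_predicate φ (star x * x))]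
      simp only [mul_assoc]
    rw [← sq_le_one_iff₀ (norm_nonneg _), sq, ← CStarRing.norm_star_mul_self, hsq]
    refine norm_cfc_le zero_le_one fun t _ => ?_
    rw [mul_left_comm, hφ_sq, norm_mul, norm_inv, Real.norm_eq_abs,
      Real.norm_of_nonneg (by positivity), ← div_eq_mul_inv, div_le_one (by positivity)]
    exact le_add_of_nonneg_left zero_le_one
  · rw [hkk]
    exact cfc_le_one _ _ fun t _ => hφ_sq_le t
  · rw [hkk, ← cfc_const_one ℝ (star x * x), ← cfc_sub _ _ _ (by fun_prop) (by fun_prop)]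
    conv_rhs => rw [← cfc_id' ℝ (star x * x)]
    refine cfc_mono (fun t ht => ?_) (by fun_prop) (by fun_prop)
    rw [hφ_sq, abs_of_nonneg (hspec t ht), sub_le_iff_le_add]
    have ht0 := hspec t ht
    field_simp
    nlinarith

theorem exists_effect_near_one_near_zero (ζ : E) {η : F}
    (hη : η ∈ (dominatedSubmodule hσ π)ᗮ) {ε : ℝ} (hε : 0 < ε) :
    ∃ f : A, 0 ≤ f ∧ f ≤ 1 ∧ (inner ℂ ζ (σ (1 - f) ζ)).re ≤ ε ∧ (inner ℂ η (π f η)).re ≤ ε := by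
  have hr : 0 < √ε := Real.sqrt_pos.2 hε
  obtain ⟨s, hs, hsζ⟩ : ∃ s : ℝ, 0 < s ∧ s * ‖ζ‖ ≤ √ε / 2 := by
    refine ⟨√ε / 2 / (‖ζ‖ + 1), by positivity, ?_⟩
    rw [div_mul_eq_mul_div, div_le_iff₀ (by positivity)]
    nlinarith [norm_nonneg ζ]
  obtain ⟨x, hxζ, hxη⟩ := exists_rep_near_one_near_zero hσ π ζ hη
    (ε := min (√ε / 2) (s * √ε)) (by positivity)
  obtain ⟨k, hk, hk_norm, hxk, hkk, hkx⟩ :=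
    exists_isSelfAdjoint_norm_mul_le_one (((s⁻¹ : ℝ) : ℂ) • x)
  refine ⟨1 - k * k, sub_nonneg.2 hkk, sub_le_self _ ?_, ?_, ?_⟩
  · simpa only [hk.star_eq] using star_mul_self_nonneg k
  · have hxk' : ‖x * k‖ ≤ s := by
      rwa [smul_mul_assoc, norm_smul, Complex.norm_real, Real.norm_of_nonneg (by positivity),
        inv_mul_le_iff₀ hs, mul_one] at hxk
    have hnorm : ‖σ k ζ‖ ≤ √ε :=
      calc ‖σ k ζ‖ ≤ ‖x * k‖ * ‖ζ‖ + ‖k‖ * ‖σ (star x) ζ - ζ‖ :=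
            norm_rep_apply_le_of_isSelfAdjoint σ hk x ζ
        _ ≤ s * ‖ζ‖ + 1 * (√ε / 2) := by
            gcongr
            exact hxζ.le.trans (min_le_left _ _)
        _ ≤ √ε := by linarith
    have hsq := rep_norm_sq σ k ζ
    rw [hk.star_eq] at hsq
    rw [sub_sub_cancel, ← hsq]
    exact_mod_cast (Real.le_sqrt (norm_nonneg _) hε.le).1 hnorm
  · have hnorm : ‖π (((s⁻¹ : ℝ) : ℂ) • x) η‖ ≤ √ε := by
      rw [map_smul, smul_apply, norm_smul, Complex.norm_real,
        Real.norm_of_nonneg (by positivity), inv_mul_le_iff₀ hs]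
      exact hxη.le.trans (min_le_right _ _)
    refine (Complex.le_def.1 (inner_rep_mono π hkx η)).1.trans ?_
    rw [← rep_norm_sq]
    exact_mod_cast (Real.le_sqrt (norm_nonneg _) hε.le).1 hnorm

end Effects

section PositiveFunctionals

variable {A : Type*} [CStarAlgebra A]
variable {F : Type*} [NormedAddCommGroup F] [InnerProductSpace ℂ F] [CompleteSpace F]

/-- The coefficient `x ↦ ⟪u, π x v⟫` of a representation. -/
noncomputable def matrixCoeff (π : A →⋆ₐ[ℂ] (F →L[ℂ] F)) (u v : F) : A →ₗ[ℂ] ℂ :=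
  (innerSL ℂ u).toLinearMap ∘ₗ orbitMap π v

theorem matrixCoeff_apply (π : A →⋆ₐ[ℂ] (F →L[ℂ] F)) (u v : F) (x : A) :
    matrixCoeff π u v x = inner ℂ u (π x v) := rfl

theorem norm_matrixCoeff_le (π : A →⋆ₐ[ℂ] (F →L[ℂ] F)) (u v : F) (x : A) :
    ‖matrixCoeff π u v x‖ ≤ ‖u‖ * ‖v‖ * ‖x‖ :=
  calc ‖matrixCoeff π u v x‖ ≤ ‖u‖ * ‖π x v‖ := norm_inner_le_norm _ _
    _ ≤ ‖u‖ * (‖x‖ * ‖v‖) := by gcongr; exact norm_rep_apply_le π x v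
    _ = ‖u‖ * ‖v‖ * ‖x‖ := by ring

theorem matrixCoeff_star_mul_self (π : A →⋆ₐ[ℂ] (F →L[ℂ] F)) (v : F) (x : A) :
    matrixCoeff π v v (star x * x) = (‖π x v‖ ^ 2 : ℂ) := (rep_norm_sq π x v).symm

theorem matrixCoeff_add_of_mem_dominatedSubmodule {E : Type*} [NormedAddCommGroup E]
    [InnerProductSpace ℂ E] [CompleteSpace E] {σ : A →⋆ₐ[ℂ] (E →L[ℂ] E)} (hσ : IsAmple σ)
    (π : A →⋆ₐ[ℂ] (F →L[ℂ] F)) {v w : F} (hv : v ∈ dominatedSubmodule hσ π)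
    (hw : w ∈ (dominatedSubmodule hσ π)ᗮ) :
    matrixCoeff π (v + w) (v + w) = matrixCoeff π v v + matrixCoeff π w w := by
  ext x
  have hvw : inner ℂ v (π x w) = 0 := (Submodule.mem_orthogonal _ _).1
    (rep_mem_dominatedSubmodule_orthogonal hσ π x hw) v hv
  have hwv : inner ℂ w (π x v) = 0 := (Submodule.mem_orthogonal' _ _).1 hw _
    (rep_mem_dominatedSubmodule hσ π x hv)
  simp only [LinearMap.add_apply, matrixCoeff_apply, map_add, inner_add_left, inner_add_right,
    hvw, hwv, add_zero, zero_add]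

variable [PartialOrder A]

/-- Positivity of a linear functional that is not bundled with it. -/
def IsPositive (φ : A →ₗ[ℂ] ℂ) : Prop := ∀ x, 0 ≤ x → 0 ≤ φ x

theorem IsPositive.re_nonneg {φ : A →ₗ[ℂ] ℂ} (hφ : IsPositive φ) {x : A} (h : 0 ≤ x) :
    0 ≤ (φ x).re := (Complex.le_def.1 (hφ x h)).1

theorem IsPositive.eq_ofReal_re {φ : A →ₗ[ℂ] ℂ} (hφ : IsPositive φ) {x : A} (h : 0 ≤ x) :
    φ x = ((φ x).re : ℂ) := Complex.eq_re_of_ofReal_le (r := 0) (by simpa using hφ x h)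

variable [StarOrderedRing A]

theorem IsPositive.mono {φ : A →ₗ[ℂ] ℂ} (hφ : IsPositive φ) {x y : A} (h : x ≤ y) :
    φ x ≤ φ y := by
  have := hφ _ (sub_nonneg.2 h)
  rwa [map_sub, sub_nonneg] at this

theorem IsPositive.re_mono {φ : A →ₗ[ℂ] ℂ} (hφ : IsPositive φ) {x y : A} (h : x ≤ y) :
    (φ x).re ≤ (φ y).re := (Complex.le_def.1 (hφ.mono h)).1

theorem isPositive_matrixCoeff (π : A →⋆ₐ[ℂ] (F →L[ℂ] F)) (v : F) :
    IsPositive (matrixCoeff π v v) := fun _ hx => inner_rep_nonneg π hx v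

theorem linearMap_ext_of_nonneg {V : Type*} [AddCommMonoid V] [Module ℂ V] {φ ψ : A →ₗ[ℂ] V}
    (h : ∀ x, 0 ≤ x → φ x = ψ x) : φ = ψ :=
  LinearMap.ext_on (s := {a : A | 0 ≤ a}) CStarAlgebra.span_nonneg fun x hx => h x hx

/-- The positive functional `φ` as a bundled map, for use with the GNS construction. -/
noncomputable def IsPositive.toPositiveLinearMap {φ : A →ₗ[ℂ] ℂ} (hφ : IsPositive φ) :
    A →ₚ[ℂ] ℂ := PositiveLinearMap.mk₀ φ hφ

/-- The cyclic vector of the GNS representation. -/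
noncomputable def IsPositive.gnsVector {φ : A →ₗ[ℂ] ℂ} (hφ : IsPositive φ) :
    hφ.toPositiveLinearMap.GNS :=
  ((hφ.toPositiveLinearMap.toPreGNS 1 : hφ.toPositiveLinearMap.PreGNS) :
    hφ.toPositiveLinearMap.GNS)

theorem IsPositive.eq_matrixCoeff_gns {φ : A →ₗ[ℂ] ℂ} (hφ : IsPositive φ) :
    φ = matrixCoeff hφ.toPositiveLinearMap.gnsStarAlgHom hφ.gnsVector hφ.gnsVector := by
  ext x
  have horbit : hφ.toPositiveLinearMap.gnsStarAlgHom x hφ.gnsVector =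
      ((hφ.toPositiveLinearMap.toPreGNS x : hφ.toPositiveLinearMap.PreGNS) :
        hφ.toPositiveLinearMap.GNS) := by
    change hφ.toPositiveLinearMap.gnsNonUnitalStarAlgHom x hφ.gnsVector = _
    rw [IsPositive.gnsVector, PositiveLinearMap.gnsNonUnitalStarAlgHom_apply_coe]
    simp
  rw [matrixCoeff_apply, horbit, IsPositive.gnsVector, UniformSpace.Completion.inner_coe,
    PositiveLinearMap.preGNS_inner_def, PositiveLinearMap.ofPreGNS_toPreGNS,
    PositiveLinearMap.ofPreGNS_toPreGNS, star_one, one_mul]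
  rfl

variable {E : Type*} [NormedAddCommGroup E] [InnerProductSpace ℂ E] [CompleteSpace E]
  {σ : A →⋆ₐ[ℂ] (E →L[ℂ] E)}

theorem IsAmple.exists_matrixCoeff_self_eq (hσ : IsAmple σ) {ξ η : E}
    (h : IsPositive (matrixCoeff σ ξ η)) :
    ∃ ζ : E, matrixCoeff σ ξ η = matrixCoeff σ ζ ζ := by
  obtain ⟨Z, hZ⟩ := hσ.exists_norm_le ξ η
  let π := h.toPositiveLinearMap.gnsStarAlgHom
  have hπ (x : A) : matrixCoeff σ ξ η (star x * x) = (‖π x h.gnsVector‖ ^ 2 : ℂ) :=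
    (DFunLike.congr_fun h.eq_matrixCoeff_gns _).trans (matrixCoeff_star_mul_self _ _ _)
  have hdom (x : A) : ‖π x h.gnsVector‖ ≤ ‖σ x Z‖ := by
    refine (sq_le_sq₀ (norm_nonneg _) (norm_nonneg _)).1 ?_
    calc ‖π x h.gnsVector‖ ^ 2 = ‖inner ℂ (σ x ξ) (σ x η)‖ := by
          rw [rep_inner_left, ← rep_mul_apply, ← matrixCoeff_apply, hπ]
          simp
      _ ≤ ‖σ x ξ‖ * ‖σ x η‖ := norm_inner_le_norm _ _
      _ ≤ ‖σ x Z‖ * ‖σ x Z‖ :=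
          mul_le_mul (hZ x).1 (hZ x).2 (norm_nonneg _) (norm_nonneg _)
      _ = ‖σ x Z‖ ^ 2 := (sq _).symm
  obtain ⟨ζ, hζ⟩ := exists_norm_rep_eq σ π hdom
  refine ⟨ζ, linearMap_ext_of_nonneg fun y hy => ?_⟩
  obtain ⟨s, rfl⟩ := CStarAlgebra.nonneg_iff_eq_star_mul_self.1 hy
  rw [hπ, hζ, matrixCoeff_star_mul_self]

variable (hσ : IsAmple σ) (π : A →⋆ₐ[ℂ] (F →L[ℂ] F))

theorem exists_le_matrixCoeff_le (ζ : E) {η : F} (hη : η ∈ (dominatedSubmodule hσ π)ᗮ)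
    {y : A} (hy : 0 ≤ y) {ε : ℝ} (hε : 0 < ε) :
    ∃ x : A, 0 ≤ x ∧ x ≤ y ∧ (matrixCoeff σ ζ ζ (y - x)).re ≤ ε ∧
      (matrixCoeff π η η x).re ≤ ε := by
  obtain ⟨s, rfl⟩ := CStarAlgebra.nonneg_iff_eq_star_mul_self.1 hy
  obtain ⟨f, hf_nonneg, hf_le, hf_near_one, hf_near_zero⟩ :=
    exists_effect_near_one_near_zero hσ π (σ s ζ)
      (rep_mem_dominatedSubmodule_orthogonal hσ π s hη) hε
  refine ⟨star s * f * s, star_left_conjugate_nonneg hf_nonneg s, ?_, ?_, ?_⟩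
  · simpa using star_left_conjugate_le_conjugate hf_le s
  · have hsub : star s * s - star s * f * s = star s * ((1 - f) * s) := by noncomm_ring
    rwa [hsub, matrixCoeff_apply, rep_mul_apply, ← rep_inner_left, rep_mul_apply]
  · rwa [matrixCoeff_apply, mul_assoc, rep_mul_apply, ← rep_inner_left, rep_mul_apply]

end PositiveFunctionals

section NormalFunctionals

variable {H : Type*} [NormedAddCommGroup H] [InnerProductSpace ℂ H] [CompleteSpace H]
variable {M : VonNeumannAlgebra H}

/-- The representation of `M` on the Hilbert sum of countably many copies of `H`, whose coefficients
are the normal functionals. -/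
noncomputable def stdRep (M : VonNeumannAlgebra H) :
    Elt M →⋆ₐ[ℂ] (lp (fun _ : ℕ => H) 2 →L[ℂ] lp (fun _ : ℕ => H) 2) :=
  (amplification ℕ).comp M.toStarSubalgebra.subtype

@[simp]
theorem stdRep_apply (x : Elt M) (v : lp (fun _ : ℕ => H) 2) (n : ℕ) :
    stdRep M x v n = (x : H →L[ℂ] H) (v n) := by
  simp [stdRep]

theorem stdRep_single (x : Elt M) (j : ℕ) (b : H) :
    stdRep M x (lp.single 2 j b) = lp.single 2 j ((x : H →L[ℂ] H) b) := by
  ext n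
  rw [stdRep_apply, lp.single_apply, lp.single_apply]
  rcases eq_or_ne n j with rfl | h
  · simp
  · simp [h]

variable (M) in
theorem isAmple_stdRep : IsAmple (stdRep M) := isAmple_amplification _

theorem isNormal_iff_exists_matrixCoeff {φ : Elt M →ₗ[ℂ] ℂ} :
    IsNormal φ ↔ ∃ ξ η : lp (fun _ : ℕ => H) 2, φ = matrixCoeff (stdRep M) ξ η := by
  constructor
  · rintro ⟨ξ, η, hξ, hη, h⟩
    have hmem (v : ℕ → H) (hv : Summable fun n => ‖v n‖ ^ 2) : Memℓp v 2 := by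
      rw [memℓp_gen_iff (by norm_num)]
      simpa using hv
    refine ⟨⟨ξ, hmem ξ hξ⟩, ⟨η, hmem η hη⟩, LinearMap.ext fun x => (h x).unique ?_⟩
    simpa [matrixCoeff_apply] using
      lp.hasSum_inner (𝕜 := ℂ) (⟨ξ, hmem ξ hξ⟩ : lp (fun _ : ℕ => H) 2)
      (stdRep M x ⟨η, hmem η hη⟩)
  · rintro ⟨ξ, η, rfl⟩
    refine ⟨ξ, η, (lp_hasSum_norm_sq ξ).summable, (lp_hasSum_norm_sq η).summable, fun x => ?_⟩
    simpa [matrixCoeff_apply] using lp.hasSum_inner (𝕜 := ℂ) ξ (stdRep M x η)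

theorem isNormal_matrixCoeff_stdRep (ξ η : lp (fun _ : ℕ => H) 2) :
    IsNormal (matrixCoeff (stdRep M) ξ η) :=
  isNormal_iff_exists_matrixCoeff.2 ⟨ξ, η, rfl⟩

theorem IsNormal.exists_bound {φ : Elt M →ₗ[ℂ] ℂ} (hφ : IsNormal φ) :
    ∃ C : ℝ, 0 ≤ C ∧ ∀ x, ‖φ x‖ ≤ C * ‖x‖ := by
  obtain ⟨ξ, η, rfl⟩ := isNormal_iff_exists_matrixCoeff.1 hφ
  exact ⟨‖ξ‖ * ‖η‖, by positivity, norm_matrixCoeff_le _ ξ η⟩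

theorem isNormal_of_norm_le {φ : Elt M →ₗ[ℂ] ℂ} {ζ : lp (fun _ : ℕ => H) 2} {C : ℝ}
    (h : ∀ x, ‖φ x‖ ≤ C * ‖stdRep M x ζ‖) : IsNormal φ := by
  let W := cyclicSubspace (stdRep M) ζ
  let e : Elt M →ₗ[ℂ] W := cyclicMap (stdRep M) ζ
  let g : W →L[ℂ] ℂ := φ.extendOfNorm e
  have hg (x : Elt M) : g (e x) = φ x :=
    LinearMap.extendOfNorm_eq (denseRange_cyclicMap (stdRep M) ζ) ⟨C, h⟩ x
  refine isNormal_iff_exists_matrixCoeff.2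
    ⟨((InnerProductSpace.toDual ℂ W).symm g : W), ζ, LinearMap.ext fun x => ?_⟩
  change φ x = inner ℂ _ ((e x : W) : lp (fun _ : ℕ => H) 2)
  rw [← hg, ← Submodule.coe_inner, InnerProductSpace.toDual_symm_apply]

theorem IsNormalState.isPositive {ρ : Elt M →ₗ[ℂ] ℂ} (hρ : IsNormalState ρ) : IsPositive ρ := by
  intro x hx
  obtain ⟨s, rfl⟩ := CStarAlgebra.nonneg_iff_eq_star_mul_self.1 hx
  exact hρ.nonneg s

theorem IsNormal.exists_eq_matrixCoeff_self {φ : Elt M →ₗ[ℂ] ℂ} (hn : IsNormal φ)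
    (hp : IsPositive φ) : ∃ ζ : lp (fun _ : ℕ => H) 2, φ = matrixCoeff (stdRep M) ζ ζ := by
  obtain ⟨ξ, η, rfl⟩ := isNormal_iff_exists_matrixCoeff.1 hn
  exact (isAmple_stdRep M).exists_matrixCoeff_self_eq hp

/-- A functional is singular if it can be made small, under any positive `y`, on an element `x` that
is close to `y` for a prescribed positive normal functional. -/
def IsSingular (ψ : Elt M →ₗ[ℂ] ℂ) : Prop :=
  ∀ y : Elt M, 0 ≤ y → ∀ ω : Elt M →ₗ[ℂ] ℂ, IsNormal ω → IsPositive ω → ∀ ε : ℝ, 0 < ε →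
    ∃ x : Elt M, 0 ≤ x ∧ x ≤ y ∧ (ω (y - x)).re ≤ ε ∧ (ψ x).re ≤ ε

theorem isNormal_matrixCoeff_of_mem_dominatedSubmodule {F : Type*} [NormedAddCommGroup F]
    [InnerProductSpace ℂ F] [CompleteSpace F] (π : Elt M →⋆ₐ[ℂ] (F →L[ℂ] F)) (u : F) {v : F}
    (hv : v ∈ dominatedSubmodule (isAmple_stdRep M) π) : IsNormal (matrixCoeff π u v) := by
  obtain ⟨ζ, hζ⟩ := hv
  exact isNormal_of_norm_le (ζ := ζ) (C := ‖u‖) fun x =>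
    (norm_inner_le_norm _ _).trans (mul_le_mul_of_nonneg_left (hζ x) (norm_nonneg _))

theorem IsPositive.exists_normal_add_singular {ψ : Elt M →ₗ[ℂ] ℂ} (hψ : IsPositive ψ) :
    ∃ ψn ψs : Elt M →ₗ[ℂ] ℂ, ψ = ψn + ψs ∧ IsNormal ψn ∧ IsPositive ψn ∧ IsPositive ψs ∧
      IsSingular ψs := by
  let π := hψ.toPositiveLinearMap.gnsStarAlgHom
  let K := dominatedSubmodule (isAmple_stdRep M) π
  let ηn := K.starProjection hψ.gnsVector
  let ηs := hψ.gnsVector - ηn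
  have hηn : ηn ∈ K := Submodule.starProjection_apply_mem K _
  have hηs : ηs ∈ Kᗮ := Submodule.sub_starProjection_mem_orthogonal _
  refine ⟨matrixCoeff π ηn ηn, matrixCoeff π ηs ηs, ?_,
    isNormal_matrixCoeff_of_mem_dominatedSubmodule π _ hηn,
    isPositive_matrixCoeff π _, isPositive_matrixCoeff π _, fun y hy ω hωn hωp ε hε => ?_⟩
  · rw [← matrixCoeff_add_of_mem_dominatedSubmodule (isAmple_stdRep M) π hηn hηs, add_sub_cancel]
    exact hψ.eq_matrixCoeff_gns
  · obtain ⟨ζ, rfl⟩ := hωn.exists_eq_matrixCoeff_self hωp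
    exact exists_le_matrixCoeff_le (isAmple_stdRep M) π ζ hηs hy hε

end NormalFunctionals

section VectorFunctionals

variable {H : Type*} [NormedAddCommGroup H] [InnerProductSpace ℂ H] [CompleteSpace H]
variable {M : VonNeumannAlgebra H}

/-- The functional `x ↦ ⟪a, x b⟫` on `M`. -/
noncomputable def vectorFunctional (M : VonNeumannAlgebra H) (a b : H) : Elt M →ₗ[ℂ] ℂ :=
  matrixCoeff M.toStarSubalgebra.subtype a b

theorem vectorFunctional_apply (a b : H) (x : Elt M) :
    vectorFunctional M a b x = inner ℂ a ((x : H →L[ℂ] H) b) := rfl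

theorem matrixCoeff_stdRep_single (i : ℕ) (a b : H) :
    matrixCoeff (stdRep M) (lp.single 2 i a) (lp.single 2 i b) = vectorFunctional M a b := by
  ext x
  rw [matrixCoeff_apply, stdRep_single, lp.inner_single_left, lp.single_apply_self,
    vectorFunctional_apply]

theorem matrixCoeff_stdRep_single_of_ne {i j : ℕ} (hij : i ≠ j) (a b : H) :
    matrixCoeff (stdRep M) (lp.single 2 i a) (lp.single 2 j b) = 0 := by
  ext x
  rw [matrixCoeff_apply, stdRep_single, lp.inner_single_left, lp.single_apply_ne _ _ _ hij,
    inner_zero_right, LinearMap.zero_apply]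

theorem isNormal_vectorFunctional (a b : H) : IsNormal (vectorFunctional M a b) :=
  matrixCoeff_stdRep_single (M := M) 0 a b ▸ isNormal_matrixCoeff_stdRep _ _

theorem isPositive_vectorFunctional (a : H) : IsPositive (vectorFunctional M a a) :=
  isPositive_matrixCoeff _ a

theorem norm_vectorFunctional_le (a b : H) (x : Elt M) :
    ‖vectorFunctional M a b x‖ ≤ ‖a‖ * ‖b‖ * ‖x‖ :=
  norm_matrixCoeff_le _ a b x

theorem norm_le_of_forall_vectorFunctional {x : Elt M} {C : ℝ} (hC : 0 ≤ C)
    (h : ∀ a b : H, ‖vectorFunctional M a b x‖ ≤ C * (‖a‖ * ‖b‖)) : ‖x‖ ≤ C := by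
  refine ContinuousLinearMap.opNorm_le_of_re_inner_le (T := (x : H →L[ℂ] H)) hC
    fun b a hb ha => ?_
  calc RCLike.re (inner ℂ ((x : H →L[ℂ] H) b) a)
      = RCLike.re (inner ℂ a ((x : H →L[ℂ] H) b)) := inner_re_symm _ _
    _ ≤ ‖vectorFunctional M a b x‖ := RCLike.re_le_norm _
    _ ≤ C := by simpa [ha, hb] using h a b

theorem nonneg_of_forall_vectorFunctional {x : Elt M}
    (h : ∀ a : H, 0 ≤ vectorFunctional M a a x) : 0 ≤ x := by
  change 0 ≤ (x : H →L[ℂ] H)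
  rw [ContinuousLinearMap.nonneg_iff_isPositive, ContinuousLinearMap.isPositive_iff_complex]
  intro a
  have ha : 0 ≤ inner ℂ ((x : H →L[ℂ] H) a) a := by
    rw [← inner_conj_symm, ← vectorFunctional_apply, (h a).isSelfAdjoint.conj_eq]
    exact h a
  exact ⟨(Complex.eq_re_of_ofReal_le (r := 0) (by simpa using ha)).symm, (Complex.le_def.1 ha).1⟩

theorem eq_of_forall_isNormal {x y : Elt M} (h : ∀ φ : Elt M →ₗ[ℂ] ℂ, IsNormal φ → φ x = φ y) :
    x = y :=
  Subtype.ext <| ContinuousLinearMap.ext fun b => ext_inner_left ℂ fun a =>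
    h _ (isNormal_vectorFunctional a b)

end VectorFunctionals

section Predual

variable {H : Type*} [NormedAddCommGroup H] [InnerProductSpace ℂ H] [CompleteSpace H]
variable {M : VonNeumannAlgebra H}

/-- A bounded linear functional on the predual of `M`, as a function on all functionals whose values
away from the normal ones are irrelevant. -/
structure IsPredualFunctional (Λ : (Elt M →ₗ[ℂ] ℂ) → ℂ) : Prop where
  map_add : ∀ φ ψ, IsNormal φ → IsNormal ψ → Λ (φ + ψ) = Λ φ + Λ ψ
  map_smul : ∀ (c : ℂ) (φ), IsNormal φ → Λ (c • φ) = c * Λ φ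
  exists_bound : ∃ C : ℝ, ∀ ξ η : lp (fun _ : ℕ => H) 2,
    ‖Λ (matrixCoeff (stdRep M) ξ η)‖ ≤ C * ‖ξ‖ * ‖η‖

variable {Λ : (Elt M →ₗ[ℂ] ℂ) → ℂ}

theorem IsPredualFunctional.map_zero (hΛ : IsPredualFunctional Λ) : Λ 0 = 0 := by
  simpa using hΛ.map_smul 0 _ (isNormal_matrixCoeff_stdRep 0 0)

theorem IsPredualFunctional.exists_inner_eq (hΛ : IsPredualFunctional Λ) :
    ∃ Y : lp (fun _ : ℕ => H) 2 →L[ℂ] lp (fun _ : ℕ => H) 2,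
      ∀ ξ η, inner ℂ ξ (Y η) = Λ (matrixCoeff (stdRep M) ξ η) := by
  obtain ⟨C, hC⟩ := hΛ.exists_bound
  let B : lp (fun _ : ℕ => H) 2 →ₗ⋆[ℂ] lp (fun _ : ℕ => H) 2 →ₗ[ℂ] ℂ :=
    LinearMap.mk₂'ₛₗ (starRingEnd ℂ) (RingHom.id ℂ) (fun ξ η => Λ (matrixCoeff (stdRep M) ξ η))
      (fun ξ ξ' η => by
        rw [← hΛ.map_add _ _ (isNormal_matrixCoeff_stdRep _ _) (isNormal_matrixCoeff_stdRep _ _)]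
        congr 1; ext x; simp [matrixCoeff_apply])
      (fun c ξ η => by
        rw [smul_eq_mul, ← hΛ.map_smul _ _ (isNormal_matrixCoeff_stdRep _ _)]
        congr 1; ext x; simp [matrixCoeff_apply, mul_comm])
      (fun ξ η η' => by
        rw [← hΛ.map_add _ _ (isNormal_matrixCoeff_stdRep _ _) (isNormal_matrixCoeff_stdRep _ _)]
        congr 1; ext x; simp [matrixCoeff_apply])
      (fun c ξ η => by
        rw [smul_eq_mul, ← hΛ.map_smul _ _ (isNormal_matrixCoeff_stdRep _ _)]
        congr 1; ext x; simp [matrixCoeff_apply])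
  refine ⟨(InnerProductSpace.continuousLinearMapOfBilin (B.mkContinuous₂ C hC)).adjoint,
    fun ξ η => ?_⟩
  rw [ContinuousLinearMap.adjoint_inner_right, InnerProductSpace.continuousLinearMapOfBilin_apply]
  rfl

theorem IsPredualFunctional.exists_vectorFunctional_eq (hΛ : IsPredualFunctional Λ) :
    ∃ y : Elt M, ∀ a b, vectorFunctional M a b y = Λ (vectorFunctional M a b) := by
  obtain ⟨Y, hY⟩ := hΛ.exists_inner_eq
  let S : H →L[ℂ] lp (fun _ : ℕ => H) 2 := lp.singleContinuousLinearMap ℂ (fun _ : ℕ => H) 2 0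
  let y : H →L[ℂ] H := S.adjoint ∘L Y ∘L S
  have hy (a b : H) : inner ℂ a (y b) = Λ (vectorFunctional M a b) := by
    rw [← matrixCoeff_stdRep_single 0, ← hY]
    simp only [y, ContinuousLinearMap.comp_apply, ContinuousLinearMap.adjoint_inner_right]
    rfl
  refine ⟨⟨y, mem_of_forall_commutant fun u hu => ContinuousLinearMap.ext fun b =>
    ext_inner_left ℂ fun a => ?_⟩, hy⟩
  change inner ℂ a (u (y b)) = inner ℂ a (y (u b))
  rw [← ContinuousLinearMap.adjoint_inner_left, hy, hy]
  congr 1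
  ext x
  rw [vectorFunctional_apply, vectorFunctional_apply, ContinuousLinearMap.adjoint_inner_left]
  exact congrArg (fun T : H →L[ℂ] H => inner ℂ a (T b)) (commutant_comm hu x).symm

theorem IsPredualFunctional.exists_forall_eq (hΛ : IsPredualFunctional Λ) :
    ∃ y : Elt M, ∀ φ, IsNormal φ → φ y = Λ φ := by
  obtain ⟨Y, hY⟩ := hΛ.exists_inner_eq
  obtain ⟨y, hy⟩ := hΛ.exists_vectorFunctional_eq
  have hcoeff (i j : ℕ) (a b : H) : inner ℂ (lp.single 2 i a) (stdRep M y (lp.single 2 j b)) =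
      inner ℂ (lp.single 2 i a) (Y (lp.single 2 j b)) := by
    rw [hY, ← matrixCoeff_apply]
    rcases eq_or_ne i j with rfl | hij
    · rw [matrixCoeff_stdRep_single, hy]
    · rw [matrixCoeff_stdRep_single_of_ne hij, hΛ.map_zero, LinearMap.zero_apply]
  have hyY : stdRep M y = Y := by
    refine lp.ext_continuousLinearMap (by norm_num) fun j => ContinuousLinearMap.ext fun b => ?_
    change stdRep M y (lp.single 2 j b) = Y (lp.single 2 j b)
    ext i
    refine ext_inner_left ℂ fun a => ?_
    have hrep := lp.inner_single_left (𝕜 := ℂ) i a (stdRep M y (lp.single 2 j b))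
    have hY := lp.inner_single_left (𝕜 := ℂ) i a (Y (lp.single 2 j b))
    exact hrep.symm.trans ((hcoeff i j a b).trans hY)
  refine ⟨y, fun φ hφ => ?_⟩
  obtain ⟨ξ, η, rfl⟩ := isNormal_iff_exists_matrixCoeff.1 hφ
  rw [matrixCoeff_apply, hyY, hY]

theorem exists_tendsto_ultrafilter {T : Type*} (U : Ultrafilter T) {f : T → ℂ} {C : ℝ}
    (hf : ∀ t, ‖f t‖ ≤ C) : ∃ z, Tendsto f U (𝓝 z) := by
  obtain ⟨z, -, hz⟩ := (isCompact_closedBall (0 : ℂ) C).ultrafilter_le_nhds (U.map f) <| by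
    rw [Ultrafilter.coe_map, le_principal_iff, mem_map]
    exact univ_mem' fun t => mem_closedBall_zero_iff.2 (hf t)
  exact ⟨z, hz⟩

theorem exists_ultrafilter_limit {T : Type*} (U : Ultrafilter T) (x : T → Elt M) {C : ℝ}
    (hx : ∀ t, ‖x t‖ ≤ C) :
    ∃ y : Elt M, ∀ φ : Elt M →ₗ[ℂ] ℂ, IsNormal φ → Tendsto (fun t => φ (x t)) U (𝓝 (φ y)) := by
  let Λ : (Elt M →ₗ[ℂ] ℂ) → ℂ := fun φ => (U : Filter T).limUnder fun t => φ (x t)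
  have hΛ {φ : Elt M →ₗ[ℂ] ℂ} (hφ : IsNormal φ) : Tendsto (fun t => φ (x t)) U (𝓝 (Λ φ)) := by
    obtain ⟨D, hD, hb⟩ := hφ.exists_bound
    exact tendsto_nhds_limUnder <| exists_tendsto_ultrafilter U fun t =>
      (hb _).trans (mul_le_mul_of_nonneg_left (hx t) hD)
  have hΛ_predual : IsPredualFunctional Λ :=
    { map_add := fun φ ψ hφ hψ => ((hΛ hφ).add (hΛ hψ)).limUnder_eq
      map_smul := fun c φ hφ => ((hΛ hφ).const_mul c).limUnder_eq
      exists_bound := by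
        refine ⟨C, fun ξ η => le_of_tendsto' (hΛ (isNormal_matrixCoeff_stdRep ξ η)).norm
          fun t => (norm_matrixCoeff_le _ ξ η (x t)).trans ?_⟩
        rw [mul_comm, ← mul_assoc]
        gcongr
        exact hx t }
  obtain ⟨y, hy⟩ := hΛ_predual.exists_forall_eq
  exact ⟨y, fun φ hφ => hy φ hφ ▸ hΛ hφ⟩

end Predual

section SetIntegrals

variable {G : Type*} [MeasurableSpace G] {m : Measure G}
variable {E : Type*} [NormedAddCommGroup E] [NormedSpace ℝ E]

theorem norm_average_le {K : Set G} (hK : m K < ∞) {f : G → E} {C : ℝ} (hC0 : 0 ≤ C)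
    (hC : ∀ g, ‖f g‖ ≤ C) : ‖(m.real K)⁻¹ • ∫ g in K, f g ∂m‖ ≤ C := by
  rw [norm_smul, Real.norm_of_nonneg (by positivity)]
  exact inv_mul_le_of_le_mul₀ measureReal_nonneg hC0 <|
    (norm_setIntegral_le_of_norm_le_const hK fun g _ => hC g).trans_eq (mul_comm _ _)

theorem measureReal_symmDiff_toMeasurable_le {K S : Set G} (hK : MeasurableSet K)
    (hKm : m K < ∞) (hS : m S < ∞) :
    m.real (symmDiff K (toMeasurable m S)) ≤ m.real (symmDiff K S) := by
  have hinter : m (symmDiff K S ∩ K) = m (K \ S) := by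
    congr 1; ext g; simp only [Set.mem_inter_iff, Set.mem_symmDiff, Set.mem_sdiff]; tauto
  have hsdiff : m (symmDiff K S \ K) = m (S \ K) := by
    congr 1; ext g; simp only [Set.mem_symmDiff, Set.mem_sdiff]; tauto
  refine ENNReal.toReal_mono (measure_symmDiff_ne_top hKm.ne hS.ne) ?_
  calc m (symmDiff K (toMeasurable m S))
      ≤ m (K \ toMeasurable m S) + m (toMeasurable m S \ K) := measure_union_le _ _
    _ ≤ m (K \ S) + m (S \ K) := by
      rw [Set.sdiff_eq (toMeasurable m S), Measure.measure_toMeasurable_inter hK.compl hS.ne,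
        ← Set.sdiff_eq]
      gcongr
      exact subset_toMeasurable m S
    _ = m (symmDiff K S) := by
      rw [← hinter, ← hsdiff, measure_inter_add_sdiff _ hK]

theorem norm_setIntegral_sub_le {K S : Set G} (hK : MeasurableSet K) (hKm : m K < ∞)
    (hS : m S < ∞) {f : G → E} (hf : AEStronglyMeasurable f m) {C : ℝ} (hC0 : 0 ≤ C)
    (hC : ∀ g, ‖f g‖ ≤ C) :
    ‖∫ g in S, f g ∂m - ∫ g in K, f g ∂m‖ ≤ C * m.real (symmDiff K S) := by
  set T := toMeasurable m S
  have hT : MeasurableSet T := measurableSet_toMeasurable _ _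
  have hTm : m T < ∞ := by rwa [measure_toMeasurable]
  have hint {R : Set G} (hR : m R < ∞) : IntegrableOn f R m :=
    Measure.integrableOn_of_bounded hR.ne hf (.of_forall hC)
  have hTK : m (T \ K) < ∞ := (measure_mono Set.sdiff_subset).trans_lt hTm
  have hKT : m (K \ T) < ∞ := (measure_mono Set.sdiff_subset).trans_lt hKm
  calc ‖∫ g in S, f g ∂m - ∫ g in K, f g ∂m‖
      = ‖∫ g in T \ K, f g ∂m - ∫ g in K \ T, f g ∂m‖ := by
        rw [← Measure.restrict_toMeasurable hS.ne, ← integral_inter_add_sdiff hK (hint hTm),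
          ← integral_inter_add_sdiff hT (hint hKm), Set.inter_comm T K, add_sub_add_left_eq_sub]
    _ ≤ C * m.real (T \ K) + C * m.real (K \ T) := (norm_sub_le _ _).trans <| add_le_add
        (norm_setIntegral_le_of_norm_le_const hTK fun g _ => hC g)
        (norm_setIntegral_le_of_norm_le_const hKT fun g _ => hC g)
    _ = C * m.real (symmDiff K T) := by
        rw [measureReal_symmDiff_eq hK hT hKm.ne hTm.ne]; ring
    _ ≤ C * m.real (symmDiff K S) :=
        mul_le_mul_of_nonneg_left (measureReal_symmDiff_toMeasurable_le hK hKm hS) hC0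

end SetIntegrals

section Averages

variable {H : Type*} [NormedAddCommGroup H] [InnerProductSpace ℂ H] [CompleteSpace H]
variable {M : VonNeumannAlgebra H} {G : Type*} {α : G → (Elt M →L[ℂ] Elt M)}

theorem IsAverage.unique [MeasurableSpace G] {m : Measure G} {K : Set G} {x y z : Elt M}
    (hy : IsAverage α m K x y) (hz : IsAverage α m K x z) : y = z :=
  eq_of_forall_isNormal fun φ hφ => by rw [hy φ hφ, hz φ hφ]

variable [Semigroup G] [TopologicalSpace G]

theorem IsDynamicalSystem.norm_apply_le (hα : IsDynamicalSystem α) (g : G) (x : Elt M) :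
    ‖α g x‖ ≤ ‖x‖ := by
  simpa using (α g).le_of_opNorm_le (hα.contraction g) x

theorem IsAverage.nonneg [MeasurableSpace G] {m : Measure G} (hα : IsDynamicalSystem α)
    {K : Set G} {x y : Elt M} (hy : IsAverage α m K x y) (hx : 0 ≤ x) : 0 ≤ y := by
  refine nonneg_of_forall_vectorFunctional fun a => ?_
  rw [hy _ (isNormal_vectorFunctional a a)]
  refine smul_nonneg (by positivity) (integral_nonneg fun g => ?_)
  exact isPositive_vectorFunctional a _ (hα.positive g x hx)

theorem IsAverage.norm_le [MeasurableSpace G] {m : Measure G} (hα : IsDynamicalSystem α)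
    {K : Set G} (hK : m K < ∞) {x y : Elt M} (hy : IsAverage α m K x y) : ‖y‖ ≤ ‖x‖ := by
  refine norm_le_of_forall_vectorFunctional (norm_nonneg x) fun a b => ?_
  rw [hy _ (isNormal_vectorFunctional a b), mul_comm]
  refine norm_average_le hK (by positivity) fun g =>
    (norm_vectorFunctional_le a b _).trans ?_
  gcongr
  exact hα.norm_apply_le g x

variable [MeasurableSpace G] [BorelSpace G] {m : Measure G}

theorem IsDynamicalSystem.integrableOn (hα : IsDynamicalSystem α) {K : Set G} (hK : m K < ∞)
    (x : Elt M) {φ : Elt M →ₗ[ℂ] ℂ} (hφ : IsNormal φ) :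
    IntegrableOn (fun g => φ (α g x)) K m := by
  obtain ⟨C, hC0, hC⟩ := hφ.exists_bound
  exact Measure.integrableOn_of_bounded (M := C * ‖x‖) hK.ne
    (hα.continuous x φ hφ).measurable.aestronglyMeasurable <| .of_forall fun g =>
      (hC _).trans (mul_le_mul_of_nonneg_left (hα.norm_apply_le g x) hC0)

theorem exists_isAverage (hα : IsDynamicalSystem α) {K : Set G} (hK : m K < ∞) (x : Elt M) :
    ∃ y : Elt M, IsAverage α m K x y := by
  refine IsPredualFunctional.exists_forall_eq
    (Λ := fun φ => ((m.real K)⁻¹ : ℝ) • ∫ g in K, φ (α g x) ∂m)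
    ⟨fun φ ψ hφ hψ => ?_, fun c φ _ => ?_, ‖x‖, fun ξ η => ?_⟩
  · simp only [LinearMap.add_apply]
    rw [integral_add (hα.integrableOn hK x hφ) (hα.integrableOn hK x hψ), smul_add]
  · simp only [LinearMap.smul_apply, smul_eq_mul]
    rw [integral_const_mul, mul_smul_comm]
  · refine norm_average_le hK (by positivity) fun g =>
      (norm_matrixCoeff_le _ ξ η _).trans ?_
    rw [mul_comm, mul_assoc]
    gcongr
    exact hα.norm_apply_le g x

theorem exists_averageMap (hα : IsDynamicalSystem α) {K : Set G} (hK : m K < ∞) :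
    ∃ A : Elt M →ₗ[ℂ] Elt M, ∀ x, IsAverage α m K x (A x) := by
  choose A hA using exists_isAverage (m := m) hα hK
  refine ⟨⟨⟨A, fun x y => ?_⟩, fun c x => ?_⟩, hA⟩
  · refine (hA (x + y)).unique fun φ hφ => ?_
    simp only [map_add]
    rw [integral_add (hα.integrableOn hK x hφ) (hα.integrableOn hK y hφ), smul_add, hA x φ hφ,
      hA y φ hφ]
  · refine (hA (c • x)).unique fun φ hφ => ?_
    simp only [RingHom.id_apply, map_smul, smul_eq_mul]
    rw [integral_const_mul, hA x φ hφ, mul_smul_comm]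

end Averages

section WeakIntegrals

variable {H : Type*} [NormedAddCommGroup H] [InnerProductSpace ℂ H] [CompleteSpace H]
variable {M : VonNeumannAlgebra H}

theorem lowerSemicontinuous_norm_of_continuous_vectorFunctional {T : Type*} [TopologicalSpace T]
    {f : T → Elt M} (hf : ∀ a b, Continuous fun t => vectorFunctional M a b (f t)) :
    LowerSemicontinuous fun t => ‖f t‖ := by
  refine lowerSemicontinuous_iff_isClosed_preimage.2 fun r => ?_
  rcases lt_or_ge r 0 with hr | hr
  · convert isClosed_empty
    exact Set.eq_empty_of_forall_notMem fun t ht => (hr.trans_le (norm_nonneg _)).not_ge ht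
  have hball : (fun t => ‖f t‖) ⁻¹' Set.Iic r =
      ⋂ p : H × H, {t | ‖vectorFunctional M p.1 p.2 (f t)‖ ≤ r * (‖p.1‖ * ‖p.2‖)} := by
    ext t
    simp only [Set.mem_preimage, Set.mem_Iic, Set.mem_iInter, Set.mem_ofPred_eq]
    refine ⟨fun ht p => (norm_vectorFunctional_le p.1 p.2 _).trans ?_, fun ht =>
      norm_le_of_forall_vectorFunctional hr fun a b => ht (a, b)⟩
    rw [mul_comm]
    gcongr
  rw [hball]
  exact isClosed_iInter fun p => isClosed_le (hf p.1 p.2).norm continuous_const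

theorem norm_le_integral_norm {T : Type*} [MeasurableSpace T] {μ : Measure T} {f : T → Elt M}
    {y : Elt M} {c : ℝ} (hc : 0 ≤ c) (hint : Integrable (fun t => ‖f t‖) μ)
    (hy : ∀ a b, vectorFunctional M a b y = c • ∫ t, vectorFunctional M a b (f t) ∂μ) :
    ‖y‖ ≤ c * ∫ t, ‖f t‖ ∂μ := by
  refine norm_le_of_forall_vectorFunctional (by positivity) fun a b => ?_
  rw [hy, norm_smul, Real.norm_of_nonneg hc, mul_assoc, ← integral_mul_const]
  refine mul_le_mul_of_nonneg_left ?_ hc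
  refine norm_integral_le_of_norm_le (hint.mul_const _) (.of_forall fun t => ?_)
  rw [mul_comm]
  exact norm_vectorFunctional_le a b _

end WeakIntegrals

section Asymptotics

variable {H : Type*} [NormedAddCommGroup H] [InnerProductSpace ℂ H] [CompleteSpace H]
variable {M : VonNeumannAlgebra H} {G : Type*} [MeasurableSpace G] {m : Measure G}
  {α : G → (Elt M →L[ℂ] Elt M)} {ι : Type*} [Preorder ι] {K : ι → Set G}

/-- The composition law `α g ∘ α h = α (c g h)`, together with the invariance of the measure and the
asymptotic invariance of the Følner net under `c · h`. It treats actions (`c g h = g * h`) and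
anti-actions (`c g h = h * g`) alike. -/
structure IsComposition [TopologicalSpace G] (α : G → (Elt M →L[ℂ] Elt M)) (m : Measure G)
    (K : ι → Set G) (c : G → G → G) : Prop where
  continuous : Continuous fun p : G × G => c p.1 p.2
  apply_apply : ∀ (g h : G) (x : Elt M), α g (α h x) = α (c g h) x
  measure_image : ∀ (h : G) (B : Set G), MeasurableSet B → m ((fun g => c g h) '' B) = m B
  tendsto : ∀ h : G, Tendsto
    (fun i => m (symmDiff (K i) ((fun g => c g h) '' K i)) / m (K i)) atTop (𝓝 0)

theorem IsDynamicalSystem.exists_isComposition [Semigroup G] [TopologicalSpace G] [ContinuousMul G]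
    (hα : IsDynamicalSystem α) (hm : IsBiinvariant m) (hK : IsFolnerNet m K) :
    ∃ c, IsComposition α m K c := by
  rcases hα.action with h | h
  · exact ⟨fun g h => g * h, continuous_mul, h, fun u B hB => (hm u B hB).2, hK.right⟩
  · exact ⟨fun g h => h * g, continuous_snd.mul continuous_fst, h, fun u B hB => (hm u B hB).1,
      hK.left⟩

variable [TopologicalSpace G] {c : G → G → G}

theorem IsComposition.continuous_left (hc : IsComposition α m K c) (h : G) :
    Continuous fun g => c g h :=
  hc.continuous.comp (continuous_id.prodMk continuous_const)

theorem IsComposition.continuous_right (hc : IsComposition α m K c) (g : G) :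
    Continuous fun h => c g h :=
  hc.continuous.comp (continuous_const.prodMk continuous_id)

variable [BorelSpace G]

theorem IsComposition.setIntegral_comp (hc : IsComposition α m K c) (h : G)
    {B : Set G} (hB : MeasurableSet B) {f : G → ℂ} (hf : Measurable f) :
    ∫ g in B, f (c g h) ∂m = ∫ g in (fun g => c g h) '' B, f g ∂m := by
  have hmeas : Measurable fun g => c g h := (hc.continuous_left h).measurable
  have hmap : (m.restrict B).map (fun g => c g h) = m.restrict ((fun g => c g h) '' B) := by
    ext S hS
    rw [Measure.map_apply hmeas hS, Measure.restrict_apply (hmeas hS), Measure.restrict_apply hS,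
      ← hc.measure_image h _ ((hmeas hS).inter hB), Set.image_preimage_inter]
  rw [← hmap, integral_map hmeas.aemeasurable hf.aestronglyMeasurable]

variable [Semigroup G]

theorem IsComposition.norm_average_sub_le (hc : IsComposition α m K c)
    (hα : IsDynamicalSystem α) {B : Set G} (hB : MeasurableSet B) (hBm : m B < ∞) (h : G)
    {x y z : Elt M} (hy : IsAverage α m B x y) (hz : IsAverage α m B (α h x) z) :
    ‖z - y‖ ≤ ‖x‖ * (m (symmDiff B ((fun g => c g h) '' B)) / m B).toReal := by
  refine norm_le_of_forall_vectorFunctional (by positivity) fun a b => ?_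
  have hmeas : Measurable fun g => vectorFunctional M a b (α g x) :=
    (hα.continuous x _ (isNormal_vectorFunctional a b)).measurable
  have hbound (g : G) : ‖vectorFunctional M a b (α g x)‖ ≤ ‖a‖ * ‖b‖ * ‖x‖ :=
    (norm_vectorFunctional_le a b _).trans
      (mul_le_mul_of_nonneg_left (hα.norm_apply_le g x) (by positivity))
  have himage : m ((fun g => c g h) '' B) < ∞ := by rwa [hc.measure_image h B hB]
  rw [map_sub, hy _ (isNormal_vectorFunctional a b), hz _ (isNormal_vectorFunctional a b),
    ← smul_sub]
  simp only [hc.apply_apply]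
  rw [hc.setIntegral_comp h hB hmeas, norm_smul, Real.norm_of_nonneg (by positivity)]
  calc (m.real B)⁻¹ * ‖_‖
      ≤ (m.real B)⁻¹ * (‖a‖ * ‖b‖ * ‖x‖ * m.real (symmDiff B ((fun g => c g h) '' B))) :=
        mul_le_mul_of_nonneg_left (norm_setIntegral_sub_le hB hBm himage
          hmeas.aestronglyMeasurable (by positivity) hbound) (by positivity)
    _ = _ := by rw [ENNReal.toReal_div, measureReal_def, measureReal_def]; ring

theorem IsComposition.tendsto_average_sub (hc : IsComposition α m K c)
    (hα : IsDynamicalSystem α) (hK : IsFolnerNet m K) {A : ι → Elt M →ₗ[ℂ] Elt M}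
    (hA : ∀ i x, IsAverage α m (K i) x (A i x)) (h : G) (x : Elt M) :
    Tendsto (fun i => ‖A i (α h x) - A i x‖) atTop (𝓝 0) := by
  refine squeeze_zero (fun _ => norm_nonneg _) (fun i => hc.norm_average_sub_le hα
    (hK.measurable i) (hK.finite i) h (hA i x) (hA i (α h x))) ?_
  simpa using ((ENNReal.tendsto_toReal ENNReal.zero_ne_top).comp (hc.tendsto h)).const_mul ‖x‖

variable [SecondCountableTopology G]

theorem IsComposition.continuous_average (hc : IsComposition α m K c)
    (hα : IsDynamicalSystem α) {B : Set G} (hBm : m B < ∞) {A : Elt M →ₗ[ℂ] Elt M}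
    (hA : ∀ x, IsAverage α m B x (A x)) (x : Elt M) {φ : Elt M →ₗ[ℂ] ℂ} (hφ : IsNormal φ) :
    Continuous fun h => φ (A (α h x)) := by
  obtain ⟨C, hC0, hC⟩ := hφ.exists_bound
  have : IsFiniteMeasure (m.restrict B) := ⟨by simpa using hBm⟩
  have horbit := hα.continuous x φ hφ
  simp only [hA _ φ hφ, hc.apply_apply]
  refine Continuous.const_smul ?_ (m.real B)⁻¹
  refine continuous_of_dominated (bound := fun _ => C * ‖x‖)
    (fun h => (horbit.comp (hc.continuous_left h)).measurable.aestronglyMeasurable)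
    (fun h => .of_forall fun g => ?_) (integrable_const _)
    (.of_forall fun g => horbit.comp (hc.continuous_right g))
  exact (hC _).trans (mul_le_mul_of_nonneg_left (hα.norm_apply_le _ x) hC0)

theorem IsComposition.average_average (hc : IsComposition α m K c)
    (hα : IsDynamicalSystem α) {B B' : Set G} (hBm : m B < ∞) (hBm' : m B' < ∞)
    {A A' : Elt M →ₗ[ℂ] Elt M}
    (hA : ∀ x, IsAverage α m B x (A x)) (hA' : ∀ x, IsAverage α m B' x (A' x)) (x : Elt M)
    {φ : Elt M →ₗ[ℂ] ℂ} (hφ : IsNormal φ) :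
    φ (A (A' x)) = ((m.real B')⁻¹ : ℝ) • ∫ h in B', φ (A (α h x)) ∂m := by
  obtain ⟨C, hC0, hC⟩ := hφ.exists_bound
  have : IsFiniteMeasure (m.restrict B) := ⟨by simpa using hBm⟩
  have : IsFiniteMeasure (m.restrict B') := ⟨by simpa using hBm'⟩
  have hinner (g : G) :
      φ (α g (A' x)) = ((m.real B')⁻¹ : ℝ) • ∫ h in B', φ (α (c g h) x) ∂m := by
    simpa only [LinearMap.comp_apply, ContinuousLinearMap.coe_coe, hc.apply_apply]
      using hA' x _ (hα.normal g φ hφ)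
  have hcont : Continuous fun p : G × G => φ (α (c p.1 p.2) x) :=
    (hα.continuous x φ hφ).comp hc.continuous
  rw [hA _ φ hφ]
  simp only [hinner, hA _ φ hφ, hc.apply_apply]
  rw [integral_smul, integral_smul, smul_comm, integral_integral_swap]
  exact Integrable.of_bound (C := C * ‖x‖) hcont.measurable.aestronglyMeasurable <|
    .of_forall fun p => (hC _).trans (mul_le_mul_of_nonneg_left (hα.norm_apply_le _ x) hC0)

theorem IsComposition.norm_average_average_sub_le (hc : IsComposition α m K c)
    (hα : IsDynamicalSystem α) {B B' : Set G} (hBm : m B < ∞) (hB'0 : 0 < m B')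
    (hBm' : m B' < ∞) {A A' : Elt M →ₗ[ℂ] Elt M} (hA : ∀ x, IsAverage α m B x (A x))
    (hA' : ∀ x, IsAverage α m B' x (A' x)) (x : Elt M)
    (hint : IntegrableOn (fun h => ‖A (α h x) - A x‖) B' m) :
    ‖A (A' x) - A x‖ ≤ (m.real B')⁻¹ * ∫ h in B', ‖A (α h x) - A x‖ ∂m := by
  have : IsFiniteMeasure (m.restrict B') := ⟨by simpa using hBm'⟩
  have hpos : m.real B' ≠ 0 := (ENNReal.toReal_pos hB'0.ne' hBm'.ne).ne'
  refine norm_le_integral_norm (by positivity) hint fun a b => ?_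
  have hn := isNormal_vectorFunctional (M := M) a b
  have hcoeff : IntegrableOn (fun h => vectorFunctional M a b (A (α h x))) B' m := by
    refine Measure.integrableOn_of_bounded (M := ‖a‖ * ‖b‖ * ‖x‖) hBm'.ne
      (hc.continuous_average hα hBm hA x hn).measurable.aestronglyMeasurable
      (.of_forall fun h => (norm_vectorFunctional_le a b _).trans ?_)
    gcongr
    exact ((hA _).norm_le hα hBm).trans (hα.norm_apply_le h x)
  simp only [map_sub]
  rw [integral_sub hcoeff (integrable_const _), smul_sub,
    ← hc.average_average hα hBm hBm' hA hA' x hn, setIntegral_const, smul_smul,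
    inv_mul_cancel₀ hpos, one_smul]

theorem IsComposition.tendsto_average_average_sub [(atTop : Filter ι).IsCountablyGenerated]
    (hc : IsComposition α m K c) (hα : IsDynamicalSystem α) (hK : IsFolnerNet m K)
    {A : ι → Elt M →ₗ[ℂ] Elt M} (hA : ∀ i x, IsAverage α m (K i) x (A i x)) (j : ι) (x : Elt M) :
    Tendsto (fun i => ‖A i (A j x) - A i x‖) atTop (𝓝 0) := by
  have : IsFiniteMeasure (m.restrict (K j)) := ⟨by simpa using hK.finite j⟩
  have hmeas (i : ι) : Measurable fun h => ‖A i (α h x) - A i x‖ := by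
    refine (lowerSemicontinuous_norm_of_continuous_vectorFunctional fun a b => ?_).measurable
    simp only [map_sub]
    exact (hc.continuous_average hα (hK.finite i) (hA i) x
      (isNormal_vectorFunctional a b)).sub continuous_const
  have hbound (i : ι) (h : G) : ‖‖A i (α h x) - A i x‖‖ ≤ ‖x‖ + ‖x‖ := by
    rw [norm_norm]
    exact (norm_sub_le _ _).trans <| add_le_add
      (((hA i _).norm_le hα (hK.finite i)).trans (hα.norm_apply_le h x))
      ((hA i x).norm_le hα (hK.finite i))
  have hint (i : ι) : IntegrableOn (fun h => ‖A i (α h x) - A i x‖) (K j) m :=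
    Integrable.of_bound (hmeas i).aestronglyMeasurable _ (.of_forall (hbound i))
  refine squeeze_zero (fun _ => norm_nonneg _) (fun i => hc.norm_average_average_sub_le hα
    (hK.finite i) (hK.pos j) (hK.finite j) (hA i) (hA j) x (hint i)) ?_
  have hlim : Tendsto (fun i => ∫ h in K j, ‖A i (α h x) - A i x‖ ∂m) atTop
      (𝓝 (∫ _ in K j, (0 : ℝ) ∂m)) :=
    tendsto_integral_filter_of_dominated_convergence (fun _ => ‖x‖ + ‖x‖)
      (.of_forall fun i => (hmeas i).aestronglyMeasurable)
      (.of_forall fun i => .of_forall (hbound i)) (integrable_const _)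
      (.of_forall fun h => hc.tendsto_average_sub hα hK hA h x)
  simpa using hlim.const_mul (m.real (K j))⁻¹

/-- `A i` is the average over the Følner set `K i`, and these averages absorb each `α g` and each
`A j` asymptotically in norm. -/
structure IsAveraging (α : G → (Elt M →L[ℂ] Elt M)) (m : Measure G) (K : ι → Set G)
    (A : ι → Elt M →ₗ[ℂ] Elt M) : Prop where
  isAverage : ∀ i x, IsAverage α m (K i) x (A i x)
  norm_le : ∀ i x, ‖A i x‖ ≤ ‖x‖
  nonneg : ∀ i x, 0 ≤ x → 0 ≤ A i x
  tendsto_translate : ∀ g x, Tendsto (fun i => ‖A i (α g x) - A i x‖) atTop (𝓝 0)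
  tendsto_average : ∀ j x, Tendsto (fun i => ‖A i (A j x) - A i x‖) atTop (𝓝 0)

theorem exists_isAveraging [ContinuousMul G] [(atTop : Filter ι).IsCountablyGenerated]
    (hα : IsDynamicalSystem α) (hm : IsBiinvariant m) (hK : IsFolnerNet m K) :
    ∃ A, IsAveraging α m K A := by
  obtain ⟨c, hc⟩ := hα.exists_isComposition hm hK
  choose A hA using fun i => exists_averageMap hα (hK.finite i)
  exact ⟨A, hA, fun i x => (hA i x).norm_le hα (hK.finite i), fun i x => (hA i x).nonneg hα,
    hc.tendsto_average_sub hα hK hA, hc.tendsto_average_average_sub hα hK hA⟩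

end Asymptotics

section Separation

variable {A : Type*} [CStarAlgebra A] [PartialOrder A] [StarOrderedRing A]

theorem IsPositive.norm_apply_le {φ : A →ₗ[ℂ] ℂ} (hφ : IsPositive φ) (x : A) :
    ‖φ x‖ ≤ (φ 1).re * ‖x‖ := by
  let π := hφ.toPositiveLinearMap.gnsStarAlgHom
  have hone : φ 1 = (‖hφ.gnsVector‖ ^ 2 : ℂ) := by
    simpa using (DFunLike.congr_fun hφ.eq_matrixCoeff_gns _).trans
      (matrixCoeff_star_mul_self π hφ.gnsVector 1)
  calc ‖φ x‖ = ‖matrixCoeff π hφ.gnsVector hφ.gnsVector x‖ := by rw [← hφ.eq_matrixCoeff_gns]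
    _ ≤ ‖hφ.gnsVector‖ * ‖hφ.gnsVector‖ * ‖x‖ := norm_matrixCoeff_le _ _ _ _
    _ = (φ 1).re * ‖x‖ := by rw [hone, ← sq]; norm_cast

theorem nonneg_of_forall_le_add_mul {a b u : ℝ} (h : ∀ s : ℝ, 0 ≤ s → u ≤ a + s * b) : 0 ≤ b := by
  by_contra! hb
  have hlim : Tendsto (fun s : ℝ => a + s * b) atTop atBot :=
    tendsto_atBot_add_const_left _ _ (tendsto_id.atTop_mul_const_of_neg hb)
  obtain ⟨s, hs, hlt⟩ := ((eventually_ge_atTop 0).and (hlim.eventually_lt_atBot u)).exists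
  exact (h s hs).not_gt hlt

variable {C : Set A} {ε : ℝ}

theorem exists_separating_functional (hC : Convex ℝ C) (hC_nonneg : ∀ c ∈ C, 0 ≤ c) (hε : 0 < ε)
    (hC_norm : ∀ c ∈ C, ε ≤ ‖c‖) :
    ∃ (f : A →L[ℂ] ℂ) (u : ℝ), 0 < u ∧ (∀ w, ‖w‖ < ε → (f w).re < u) ∧
      ∀ c ∈ C, ∀ w, c ≤ (realPart w : A) → u ≤ (f w).re := by
  let t : Set A := {w | ∃ c ∈ C, c ≤ (realPart w : A)}
  have ht : Convex ℝ t := by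
    rintro w₁ ⟨c₁, hc₁, h₁⟩ w₂ ⟨c₂, hc₂, h₂⟩ a b ha hb hab
    refine ⟨a • c₁ + b • c₂, hC hc₁ hc₂ ha hb hab, ?_⟩
    rw [map_add, map_smul, map_smul]
    exact add_le_add (smul_le_smul_of_nonneg_left h₁ ha) (smul_le_smul_of_nonneg_left h₂ hb)
  have hdisj : Disjoint (Metric.ball (0 : A) ε) t := by
    rw [Set.disjoint_left]
    rintro w hw ⟨c, hc, hcw⟩
    rw [mem_ball_zero_iff] at hw
    refine hw.not_ge ?_
    calc ε ≤ ‖c‖ := hC_norm c hc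
      _ ≤ ‖(realPart w : A)‖ := CStarAlgebra.norm_le_norm_of_nonneg_of_le (hC_nonneg c hc) hcw
      _ ≤ ‖w‖ := realPart.norm_le w
  obtain ⟨f, u, hball, hsep⟩ := RCLike.geometric_hahn_banach_open (𝕜 := ℂ)
    (convex_ball (0 : A) ε) Metric.isOpen_ball ht hdisj
  exact ⟨f, u, by simpa using hball 0 (Metric.mem_ball_self hε),
    fun w hw => hball w (mem_ball_zero_iff.2 hw), fun c hc w hw => hsep w ⟨c, hc, hw⟩⟩

theorem isPositive_of_forall_le_re {f : A →ₗ[ℂ] ℂ} {c : A} (hc : 0 ≤ c) {u : ℝ}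
    (hf : ∀ w, c ≤ (realPart w : A) → u ≤ (f w).re) : IsPositive f := by
  have hre (z : A) (hz : 0 ≤ (realPart z : A)) : 0 ≤ (f z).re := by
    refine nonneg_of_forall_le_add_mul (a := (f c).re) (u := u) fun s hs => ?_
    have hle : c ≤ (realPart (c + (s : ℂ) • z) : A) := by
      rw [Complex.coe_smul, map_add, map_smul]
      change c ≤ (realPart c : A) + s • (realPart z : A)
      rw [hc.isSelfAdjoint.coe_realPart]
      exact le_add_of_nonneg_right (smul_nonneg hs hz)
    simpa using hf _ hle
  intro z hz
  have hI : (realPart (Complex.I • z) : A) = 0 := by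
    simp [realPart_I_smul, hz.isSelfAdjoint.imaginaryPart]
  have him_le := hre (Complex.I • z) hI.ge
  have hle_im := hre (-(Complex.I • z)) (by rw [map_neg, NegMemClass.coe_neg, hI, neg_zero])
  simp only [map_neg, map_smul, smul_eq_mul, Complex.neg_re, Complex.I_mul_re] at him_le hle_im
  exact Complex.le_def.2 ⟨hre z (by rwa [hz.isSelfAdjoint.coe_realPart]),
    show 0 = (f z).im by linarith⟩

theorem exists_state_forall_le_re (hC : Convex ℝ C) (hne : C.Nonempty)
    (hC_nonneg : ∀ c ∈ C, 0 ≤ c) (hε : 0 < ε) (hC_norm : ∀ c ∈ C, ε ≤ ‖c‖) :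
    ∃ μ : A →ₗ[ℂ] ℂ, IsPositive μ ∧ μ 1 = 1 ∧ ∀ c ∈ C, ε ≤ (μ c).re := by
  obtain ⟨f, u, hu, hball, hsep⟩ := exists_separating_functional hC hC_nonneg hε hC_norm
  obtain ⟨c₀, hc₀⟩ := hne
  have hpos : IsPositive (f : A →ₗ[ℂ] ℂ) :=
    isPositive_of_forall_le_re (hC_nonneg c₀ hc₀) (hsep c₀ hc₀)
  have hle (c : A) (hc : c ∈ C) : u ≤ (f c).re :=
    hsep c hc c (hC_nonneg c hc).isSelfAdjoint.coe_realPart.ge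
  have hone : f 1 = ((f 1).re : ℂ) := hpos.eq_ofReal_re zero_le_one
  have hone_pos : 0 < (f 1).re := by
    refine pos_of_mul_pos_left ?_ (norm_nonneg c₀)
    calc 0 < u := hu
      _ ≤ (f c₀).re := hle c₀ hc₀
      _ ≤ ‖f c₀‖ := Complex.re_le_norm _
      _ ≤ (f 1).re * ‖c₀‖ := hpos.norm_apply_le c₀
  have hone_ne : f 1 ≠ 0 := fun h => hone_pos.ne' (by simp [h])
  have : Nontrivial A := ⟨1, 0, fun h => hone_ne (by rw [h, map_zero])⟩
  have hmul_le : ε * (f 1).re ≤ u := by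
    by_contra! hlt
    have hnorm : ‖((u / (f 1).re : ℝ) : ℂ) • (1 : A)‖ < ε := by
      rw [norm_smul, norm_one, mul_one, Complex.norm_real,
        Real.norm_of_nonneg (div_pos hu hone_pos).le]
      exact (div_lt_iff₀ hone_pos).2 hlt
    have := hball _ hnorm
    rw [map_smul, smul_eq_mul, Complex.re_ofReal_mul, div_mul_cancel₀ _ hone_pos.ne'] at this
    exact this.false
  refine ⟨((((f 1).re)⁻¹ : ℝ) : ℂ) • (f : A →ₗ[ℂ] ℂ), fun z hz => ?_, ?_, fun c hc => ?_⟩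
  · exact mul_nonneg (Complex.zero_le_real.2 (inv_nonneg.2 hone_pos.le)) (hpos z hz)
  · change ((((f 1).re)⁻¹ : ℝ) : ℂ) * f 1 = 1
    rw [Complex.ofReal_inv, ← hone, inv_mul_cancel₀ hone_ne]
  · change ε ≤ (((((f 1).re)⁻¹ : ℝ) : ℂ) * f c).re
    rw [Complex.re_ofReal_mul, inv_mul_eq_div, le_div_iff₀ hone_pos]
    exact hmul_le.trans (hle c hc)

end Separation

section Wandering

theorem IsPositive.eq_of_le_of_map_one_le {A : Type*} [CStarAlgebra A] [PartialOrder A]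
    [StarOrderedRing A] {φ ψ : A →ₗ[ℂ] ℂ} (hφ : IsPositive φ) (hψ : IsPositive ψ)
    (hle : ∀ x, 0 ≤ x → (φ x).re ≤ (ψ x).re) (hone : (ψ 1).re ≤ (φ 1).re) : φ = ψ := by
  refine linearMap_ext_of_nonneg fun x hx => ?_
  rw [hφ.eq_ofReal_re hx, hψ.eq_ofReal_re hx]
  refine congrArg _ (le_antisymm (hle x hx) ?_)
  have hx_le : x ≤ ((‖x‖ : ℝ) : ℂ) • (1 : A) := by
    rw [Complex.coe_smul, ← Algebra.algebraMap_eq_smul_one]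
    exact IsSelfAdjoint.le_algebraMap_norm_self hx.isSelfAdjoint
  have hcompl := hle _ (sub_nonneg.2 hx_le)
  simp only [map_sub, map_smul, smul_eq_mul, Complex.sub_re, Complex.re_ofReal_mul] at hcompl
  nlinarith [norm_nonneg x]

variable {H : Type*} [NormedAddCommGroup H] [InnerProductSpace ℂ H] [CompleteSpace H]
variable {M : VonNeumannAlgebra H} {G : Type*} {α : G → (Elt M →L[ℂ] Elt M)}

/-- A `G`-invariant positive normal functional, not necessarily normalized. -/
structure IsInvariantFunctional (α : G → (Elt M →L[ℂ] Elt M)) (θ : Elt M →ₗ[ℂ] ℂ) : Prop where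
  normal : IsNormal θ
  positive : IsPositive θ
  invariant : ∀ g x, θ (α g x) = θ x

theorem IsDynamicalSystem.exists_isInvariantFunctional_add_isSingular [Semigroup G]
    [TopologicalSpace G] (hα : IsDynamicalSystem α) {ψ : Elt M →ₗ[ℂ] ℂ} (hψ : IsPositive ψ)
    (hinv : ∀ g x, ψ (α g x) = ψ x) :
    ∃ ψn ψs : Elt M →ₗ[ℂ] ℂ, ψ = ψn + ψs ∧ IsInvariantFunctional α ψn ∧ IsSingular ψs := by
  obtain ⟨ψn, ψs, rfl, hn, hnp, hsp, hsing⟩ := hψ.exists_normal_add_singular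
  have hinv_re (g : G) (x : Elt M) :
      (ψn (α g x)).re + (ψs (α g x)).re = (ψn x).re + (ψs x).re := by
    simpa using congrArg Complex.re (hinv g x)
  refine ⟨ψn, ψs, rfl, ⟨hn, hnp, fun g => ?_⟩, hsing⟩
  let ω : Elt M →ₗ[ℂ] ℂ := ψn ∘ₗ (α g : Elt M →ₗ[ℂ] Elt M)
  have hωn : IsNormal ω := hα.normal g ψn hn
  have hωp : IsPositive ω := fun x hx => hnp _ (hα.positive g x hx)
  -- Where `ψs` is small, invariance of `ψn + ψs` bounds `ω` by `ψn`.
  have hω_le (x : Elt M) (hx : 0 ≤ x) : (ω x).re ≤ (ψn x).re := by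
    refine le_of_forall_pos_le_add fun ε hε => ?_
    obtain ⟨z, hz0, hzx, hωz, hsz⟩ := hsing x hx ω hωn hωp (ε / 2) (half_pos hε)
    have hsplit : (ω x).re = (ω (x - z)).re + (ψn (α g z)).re := by
      rw [map_sub, Complex.sub_re]
      exact (sub_add_cancel _ _).symm
    linarith [hinv_re g z, hnp.re_mono hzx, hsp.re_nonneg (hα.positive g z hz0)]
  have hω_one : (ψn 1).re ≤ (ω 1).re := by
    change _ ≤ (ψn (α g 1)).re
    linarith [hinv_re g 1, hsp.re_mono (hα.subunital g)]
  exact DFunLike.congr_fun (hωp.eq_of_le_of_map_one_le hnp hω_le hω_one)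

variable [MeasurableSpace G] {m : Measure G} {ι : Type*} [Preorder ι] {K : ι → Set G}
  {A : ι → Elt M →ₗ[ℂ] Elt M}

theorem IsAveraging.isWeaklyWandering_iff (hA : IsAveraging α m K A) {x : Elt M} :
    IsWeaklyWandering α m K x ↔ 0 ≤ x ∧ Tendsto (fun i => A i x) atTop (𝓝 0) := by
  rw [tendsto_zero_iff_norm_tendsto_zero]
  refine and_congr_right fun _ => ⟨?_, fun h => ⟨fun i => A i x, fun i => hA.isAverage i x, h⟩⟩
  rintro ⟨B, hB, h⟩
  exact h.congr fun i => congrArg norm ((hB i).unique (hA.isAverage i x))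

theorem IsAveraging.isWeaklyWandering_of_exists_norm_lt (hA : IsAveraging α m K A) {x : Elt M}
    (hx : 0 ≤ x) (h : ∀ ε : ℝ, 0 < ε → ∃ i, ‖A i x‖ < ε) : IsWeaklyWandering α m K x := by
  refine hA.isWeaklyWandering_iff.2 ⟨hx, Metric.tendsto_nhds.2 fun ε hε => ?_⟩
  obtain ⟨j, hj⟩ := h (ε / 2) (half_pos hε)
  filter_upwards [(hA.tendsto_average j x).eventually_lt_const (half_pos hε)] with i hi
  rw [dist_zero_right]
  calc ‖A i x‖ ≤ ‖A i (A j x)‖ + ‖A i (A j x) - A i x‖ := by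
        simpa using norm_sub_le (A i (A j x)) (A i (A j x) - A i x)
    _ < ε / 2 + ε / 2 := add_lt_add ((hA.norm_le i _).trans_lt hj) hi
    _ = ε := add_halves ε

variable [Nonempty ι] [IsDirectedOrder ι]

theorem IsAveraging.exists_invariant_limit (hA : IsAveraging α m K A) {μ : ι → Elt M →ₗ[ℂ] ℂ}
    (hμ : ∀ i, IsPositive (μ i)) (hμ_one : ∀ i, μ i 1 = 1) :
    ∃ ψ : Elt M →ₗ[ℂ] ℂ, IsPositive ψ ∧ (∀ g x, ψ (α g x) = ψ x) ∧
      ∀ x c, (∀ i, c ≤ (μ i (A i x)).re) → c ≤ (ψ x).re := by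
  let U : Ultrafilter ι := Ultrafilter.of atTop
  have hU : (U : Filter ι) ≤ atTop := Ultrafilter.of_le atTop
  have hμ_norm (i : ι) (x : Elt M) : ‖μ i x‖ ≤ ‖x‖ := by
    simpa [hμ_one] using (hμ i).norm_apply_le x
  choose ψ hψ using fun x => exists_tendsto_ultrafilter U (f := fun i => μ i (A i x)) fun i =>
    (hμ_norm i _).trans (hA.norm_le i x)
  refine ⟨⟨⟨ψ, fun x y => ?_⟩, fun c x => ?_⟩, fun x hx => ?_, fun g x => ?_, fun x c hc => ?_⟩
  · refine tendsto_nhds_unique (hψ (x + y)) ?_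
    simpa using (hψ x).add (hψ y)
  · refine tendsto_nhds_unique (hψ (c • x)) ?_
    simpa using (hψ x).const_mul c
  · exact ge_of_tendsto' (hψ x) fun i => hμ i _ (hA.nonneg i x hx)
  · refine sub_eq_zero.1 (tendsto_nhds_unique ((hψ (α g x)).sub (hψ x)) ?_)
    refine squeeze_zero_norm (fun i => ?_) ((hA.tendsto_translate g x).mono_left hU)
    rw [← map_sub]
    exact hμ_norm i _
  · exact ge_of_tendsto' ((Complex.continuous_re.tendsto _).comp (hψ x)) hc

variable [Semigroup G] [TopologicalSpace G] {y : Elt M} {φ : Elt M →ₗ[ℂ] ℂ}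

theorem IsAveraging.exists_norm_average_lt (hα : IsDynamicalSystem α) (hA : IsAveraging α m K A)
    (hy0 : 0 ≤ y) (hy : ∀ θ, IsInvariantFunctional α θ → θ y = 0) (hφn : IsNormal φ)
    (hφp : IsPositive φ) {δ ε : ℝ} (hδ : 0 < δ) (hε : 0 < ε) :
    ∃ i x, 0 ≤ x ∧ x ≤ y ∧ (φ y).re - δ ≤ (φ x).re ∧ ‖A i x‖ < ε := by
  by_contra! hcon
  let S : Set (Elt M) := Set.Icc 0 y ∩ {x | (φ y).re - δ ≤ (φ x).re}
  have hφ_lin : IsLinearMap ℝ fun x : Elt M => (φ x).re :=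
    ⟨fun x z => by simp, fun c x => by rw [← Complex.coe_smul, map_smul]; simp⟩
  have hS : Convex ℝ S := (convex_Icc 0 y).inter (convex_halfSpace_ge hφ_lin _)
  have hyS : y ∈ S := ⟨⟨hy0, le_rfl⟩, by simpa using hδ.le⟩
  choose μ hμp hμ_one hμS using fun i => exists_state_forall_le_re
    (C := A i '' S) (hS.is_linear_image ((A i).restrictScalars ℝ).isLinear) ⟨_, y, hyS, rfl⟩
    (Set.forall_mem_image.2 fun x hx => hA.nonneg i x hx.1.1) hε
    (Set.forall_mem_image.2 fun x hx => hcon i x hx.1.1 hx.1.2 hx.2)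
  obtain ⟨ψ, hψp, hψinv, hψ⟩ := hA.exists_invariant_limit hμp hμ_one
  obtain ⟨ψn, ψs, rfl, hn, hsing⟩ := hα.exists_isInvariantFunctional_add_isSingular hψp hψinv
  obtain ⟨x, hx0, hxy, hφx, hsx⟩ :=
    hsing y hy0 φ hφn hφp (min δ (ε / 2)) (lt_min hδ (half_pos hε))
  have hxS : x ∈ S := by
    refine ⟨⟨hx0, hxy⟩, ?_⟩
    rw [map_sub, Complex.sub_re] at hφx
    exact sub_le_comm.1 (hφx.trans (min_le_left _ _))
  have hlarge : ε ≤ (ψn x).re + (ψs x).re :=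
    hψ x ε fun i => hμS i _ (Set.mem_image_of_mem _ hxS)
  have hnormal : (ψn x).re ≤ 0 := by simpa [hy ψn hn] using hn.positive.re_mono hxy
  linarith [hsx.trans (min_le_right _ _)]

theorem IsAveraging.exists_antitone_seq (hα : IsDynamicalSystem α) (hA : IsAveraging α m K A)
    (hy0 : 0 ≤ y) (hy : ∀ θ, IsInvariantFunctional α θ → θ y = 0) (hφn : IsNormal φ)
    (hφp : IsPositive φ) (hφy : 0 < (φ y).re) :
    ∃ (s : ℕ → Elt M) (I : ℕ → ι), Antitone s ∧ (∀ n, 0 ≤ s n) ∧ (∀ n, s n ≤ y) ∧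
      (∀ n, (φ y).re / 2 ≤ (φ (s n)).re) ∧ ∀ n : ℕ, ‖A (I n) (s (n + 1))‖ < 1 / (n + 1) := by
  let Z := {z : Elt M // 0 ≤ z ∧ z ≤ y ∧ (φ y).re / 2 < (φ z).re}
  have step (n : ℕ) (z : Z) : ∃ (i : ι) (x : Z), x.1 ≤ z.1 ∧ ‖A i x.1‖ < 1 / (n + 1) := by
    obtain ⟨z, hz0, hzy, hφz⟩ := z
    have hz (θ : Elt M →ₗ[ℂ] ℂ) (hθ : IsInvariantFunctional α θ) : θ z = 0 :=
      le_antisymm ((hθ.positive.mono hzy).trans_eq (hy θ hθ)) (hθ.positive z hz0)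
    obtain ⟨i, x, hx0, hxz, hφx, hAx⟩ := hA.exists_norm_average_lt hα hz0 hz hφn hφp
      (half_pos (sub_pos.2 hφz)) (Nat.one_div_pos_of_nat (α := ℝ) (n := n))
    exact ⟨i, ⟨x, hx0, hxz.trans hzy, by linarith⟩, hxz, hAx⟩
  choose I f hf_le hf_norm using step
  let s (n : ℕ) : Z := Nat.rec ⟨y, hy0, le_rfl, half_lt_self hφy⟩ (fun k z => f k z) n
  exact ⟨fun n => (s n).1, fun n => I n (s n), antitone_nat_of_succ_le fun n => hf_le n (s n),
    fun n => (s n).2.1, fun n => (s n).2.2.1, fun n => (s n).2.2.2.le,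
    fun n => hf_norm n (s n)⟩

theorem exists_lowerBound_of_antitone {s : ℕ → Elt M} (hs : Antitone s) (hs0 : ∀ n, 0 ≤ s n) :
    ∃ x, 0 ≤ x ∧ (∀ n, x ≤ s n) ∧ ∀ φ : Elt M →ₗ[ℂ] ℂ, IsNormal φ →
      ∀ c, (∀ n, c ≤ (φ (s n)).re) → c ≤ (φ x).re := by
  obtain ⟨x, hx⟩ := exists_ultrafilter_limit (hyperfilter ℕ) s (C := ‖s 0‖) fun n =>
    CStarAlgebra.norm_le_norm_of_nonneg_of_le (hs0 n) (hs (Nat.zero_le n))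
  refine ⟨x, nonneg_of_forall_vectorFunctional fun a => ?_, fun n => sub_nonneg.1 <|
    nonneg_of_forall_vectorFunctional fun a => ?_, fun φ hφ c hc => ?_⟩
  · exact ge_of_tendsto' (hx _ (isNormal_vectorFunctional a a)) fun n =>
      isPositive_vectorFunctional a _ (hs0 n)
  · rw [map_sub, sub_nonneg]
    refine le_of_tendsto (hx _ (isNormal_vectorFunctional a a)) ?_
    filter_upwards [Nat.hyperfilter_le_atTop (eventually_ge_atTop n)] with k hk
    exact (isPositive_vectorFunctional a).mono (hs hk)
  · exact ge_of_tendsto' ((Complex.continuous_re.tendsto _).comp (hx φ hφ)) hc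

theorem IsAveraging.exists_isWeaklyWandering_le (hα : IsDynamicalSystem α)
    (hA : IsAveraging α m K A) (hy0 : 0 ≤ y)
    (hy : ∀ θ, IsInvariantFunctional α θ → θ y = 0) (hφn : IsNormal φ) (hφp : IsPositive φ)
    (hφy : 0 < (φ y).re) : ∃ x, IsWeaklyWandering α m K x ∧ x ≤ y ∧ x ≠ 0 := by
  obtain ⟨s, I, hs, hs0, hsy, hφs, hAs⟩ := hA.exists_antitone_seq hα hy0 hy hφn hφp hφy
  obtain ⟨x, hx0, hxs, hx⟩ := exists_lowerBound_of_antitone hs hs0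
  refine ⟨x, hA.isWeaklyWandering_of_exists_norm_lt hx0 fun ε hε => ?_,
    (hxs 0).trans (hsy 0), ?_⟩
  · obtain ⟨n, hn⟩ := exists_nat_one_div_lt hε
    refine ⟨I n, lt_of_le_of_lt ?_ ((hAs n).trans hn)⟩
    refine CStarAlgebra.norm_le_norm_of_nonneg_of_le (hA.nonneg _ _ hx0) ?_
    simpa using hA.nonneg (I n) _ (sub_nonneg.2 (hxs (n + 1)))
  · rintro rfl
    have hle := hx φ hφn _ hφs
    rw [map_zero, Complex.zero_re] at hle
    linarith

end Wandering

section Projections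

theorem star_mul_self_of_isStarProjection {R : Type*} [Mul R] [Star R] {p : R}
    (hp : IsStarProjection p) : star p * p = p := by
  rw [hp.isSelfAdjoint.star_eq, hp.isIdempotentElem.eq]

theorem mul_eq_zero_comm_of_isSelfAdjoint {R : Type*} [NonUnitalSemiring R] [StarRing R] {a b : R}
    (ha : IsSelfAdjoint a) (hb : IsSelfAdjoint b) (h : a * b = 0) : b * a = 0 :=
  ((ha.commute_iff hb).2 (h ▸ .zero R)).eq.symm.trans h

variable {A : Type*} [CStarAlgebra A] [PartialOrder A] [StarOrderedRing A]

theorem one_sub_mul_eq_zero_iff_le {p q : A} (hp : IsStarProjection p)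
    (hq : IsStarProjection q) : (1 - q) * p = 0 ↔ p ≤ q := by
  rw [hp.le_iff_mul_eq_right hq, sub_mul, one_mul, sub_eq_zero, eq_comm]

theorem mul_eq_zero_of_le {a b y : A} (ha : 0 ≤ a) (hab : a ≤ b) (h : y * b = 0) :
    y * a = 0 := by
  obtain ⟨s, rfl⟩ := CStarAlgebra.nonneg_iff_eq_star_mul_self.1 ha
  have hle : (y * star s) * star (y * star s) ≤ 0 := by
    simpa [h, mul_assoc] using star_right_conjugate_le_conjugate hab y
  have hzero : y * star s = 0 :=
    CStarRing.mul_star_self_eq_zero_iff _ |>.1 (hle.antisymm (mul_star_self_nonneg _))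
  rw [← mul_assoc, hzero, zero_mul]

end Projections

section Supports

variable {H : Type*} [NormedAddCommGroup H] [InnerProductSpace ℂ H] [CompleteSpace H]
variable (M : VonNeumannAlgebra H)

/-- The vectors killed by every element of `M` that kills `S`. By the double commutant theorem this
is the closed span of `M' S`. -/
def annihilatorHull (S : Set H) : Submodule ℂ H :=
  ⨅ x : {x : Elt M // ∀ s ∈ S, (x : H →L[ℂ] H) s = 0}, ((x : Elt M) : H →L[ℂ] H).ker

theorem mem_annihilatorHull {S : Set H} {η : H} :
    η ∈ annihilatorHull M S ↔
      ∀ x : Elt M, (∀ s ∈ S, (x : H →L[ℂ] H) s = 0) → (x : H →L[ℂ] H) η = 0 := by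
  simp [annihilatorHull, Submodule.mem_iInf]

instance (S : Set H) : CompleteSpace (annihilatorHull M S) :=
  have hclosed : IsClosed (annihilatorHull M S : Set H) := by
    rw [annihilatorHull, Submodule.coe_iInf]
    exact isClosed_iInter fun x => ContinuousLinearMap.isClosed_ker _
  hclosed.completeSpace_coe

theorem starProjection_annihilatorHull_mem (S : Set H) :
    (annihilatorHull M S).starProjection ∈ M := by
  rw [VonNeumannAlgebra.IsStarProjection.mem_iff isStarProjection_starProjection]
  intro u hu
  rw [Submodule.range_starProjection, Module.End.mem_invtSubmodule]
  intro η hη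
  refine (mem_annihilatorHull M).2 fun x hx => ?_
  have hcomm : (x : H →L[ℂ] H) (u η) = u ((x : H →L[ℂ] H) η) :=
    congrArg (fun T : H →L[ℂ] H => T η) (commutant_comm hu x)
  change (x : H →L[ℂ] H) (u η) = 0
  rw [hcomm, (mem_annihilatorHull M).1 hη x hx, map_zero]

variable {M}

/-- `e` is the support projection in `M` of a set of vectors: it is a projection, and an element of
`M` kills `S` if and only if it is annihilated by `e` on the right. -/
structure IsVectorSupport (S : Set H) (e : Elt M) : Prop where
  isStarProjection : IsStarProjection e
  mul_eq_zero_iff : ∀ x : Elt M, x * e = 0 ↔ ∀ s ∈ S, (x : H →L[ℂ] H) s = 0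

theorem eq_zero_iff_forall_apply {x : Elt M} : x = 0 ↔ ∀ η, (x : H →L[ℂ] H) η = 0 := by
  rw [← ZeroMemClass.coe_eq_zero, ContinuousLinearMap.ext_iff]
  rfl

variable (M) in
theorem exists_isVectorSupport (S : Set H) : ∃ e : Elt M, IsVectorSupport S e := by
  let P := (annihilatorHull M S).starProjection
  have hP : IsStarProjection P := isStarProjection_starProjection
  refine ⟨⟨P, starProjection_annihilatorHull_mem M S⟩,
    ⟨Subtype.ext hP.1, Subtype.ext hP.2⟩, fun x => ?_⟩
  rw [eq_zero_iff_forall_apply]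
  change (∀ η, (x : H →L[ℂ] H) (P η) = 0) ↔ _
  constructor
  · intro h s hs
    have hmem : s ∈ annihilatorHull M S := (mem_annihilatorHull M).2 fun y hy => hy s hs
    rw [← Submodule.starProjection_eq_self_iff.2 hmem]
    exact h s
  · exact fun h η => (mem_annihilatorHull M).1 (Submodule.starProjection_apply_mem _ η) x h

theorem IsVectorSupport.ne_zero {ξ : H} {e : Elt M} (he : IsVectorSupport {ξ} e) (hξ : ξ ≠ 0) :
    e ≠ 0 := by
  rintro rfl
  exact hξ ((he.mul_eq_zero_iff 1).1 (mul_zero 1) ξ rfl)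

theorem exists_isStarProjection_mul_eq_zero_iff (a : Elt M) :
    ∃ e : Elt M, IsStarProjection e ∧ ∀ y : Elt M, y * a = 0 ↔ y * e = 0 := by
  obtain ⟨e, he⟩ := exists_isVectorSupport M (Set.range (a : H →L[ℂ] H))
  refine ⟨e, he.isStarProjection, fun y => ?_⟩
  rw [he.mul_eq_zero_iff, Set.forall_mem_range, eq_zero_iff_forall_apply]
  rfl

theorem isOperatorSupport_iff {a e : Elt M} :
    IsOperatorSupport a e ↔ IsStarProjection e ∧ ∀ y : Elt M, y * a = 0 ↔ y * e = 0 := by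
  have of_annihilator : ∀ e : Elt M, IsStarProjection e → (∀ y : Elt M, y * a = 0 ↔ y * e = 0) →
      IsOperatorSupport a e := by
    refine fun e he h => ⟨⟨he, ?_⟩, fun p hp => ?_⟩
    · have hea := (h (1 - e)).2 he.one_sub_mul_self
      rw [sub_mul, one_mul, sub_eq_zero] at hea
      exact hea.symm
    · refine (one_sub_mul_eq_zero_iff_le he hp.1).1 ((h _).1 ?_)
      rw [sub_mul, one_mul, hp.2, sub_self]
  refine ⟨fun h => ?_, fun h => of_annihilator e h.1 h.2⟩
  obtain ⟨f, hf, hfa⟩ := exists_isStarProjection_mul_eq_zero_iff a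
  rw [h.unique (of_annihilator f hf hfa)]
  exact ⟨hf, hfa⟩

theorem exists_isOperatorSupport (a : Elt M) : ∃ e, IsOperatorSupport a e := by
  simpa only [isOperatorSupport_iff] using exists_isStarProjection_mul_eq_zero_iff a

theorem matrixCoeff_stdRep_star_mul_self_eq_zero_iff (ζ : lp (fun _ : ℕ => H) 2) (x : Elt M) :
    matrixCoeff (stdRep M) ζ ζ (star x * x) = 0 ↔ ∀ n, (x : H →L[ℂ] H) (ζ n) = 0 := by
  rw [matrixCoeff_star_mul_self, sq_eq_zero_iff, Complex.ofReal_eq_zero, norm_eq_zero, lp.ext_iff,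
    funext_iff]
  simp only [stdRep_apply, lp.coeFn_zero, Pi.zero_apply]

theorem IsNormal.exists_isStarProjection_mul_eq_zero_iff {φ : Elt M →ₗ[ℂ] ℂ} (hn : IsNormal φ)
    (hp : IsPositive φ) :
    ∃ e : Elt M, IsStarProjection e ∧ ∀ x : Elt M, φ (star x * x) = 0 ↔ x * e = 0 := by
  obtain ⟨ζ, rfl⟩ := hn.exists_eq_matrixCoeff_self hp
  obtain ⟨e, he⟩ := exists_isVectorSupport M (Set.range fun n => ζ n)
  refine ⟨e, he.isStarProjection, fun x => ?_⟩
  rw [matrixCoeff_stdRep_star_mul_self_eq_zero_iff, he.mul_eq_zero_iff, Set.forall_mem_range]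

theorem isFunctionalSupport_iff {φ : Elt M →ₗ[ℂ] ℂ} (hn : IsNormal φ) (hp : IsPositive φ)
    {e : Elt M} :
    IsFunctionalSupport φ e ↔
      IsStarProjection e ∧ ∀ x : Elt M, φ (star x * x) = 0 ↔ x * e = 0 := by
  have of_annihilator : ∀ e : Elt M, IsStarProjection e →
      (∀ x : Elt M, φ (star x * x) = 0 ↔ x * e = 0) → IsFunctionalSupport φ e := by
    refine fun e he h => ⟨⟨he.one_sub, ?_⟩, fun p ⟨hp, hφp⟩ => ?_⟩
    · rw [← star_mul_self_of_isStarProjection he.one_sub]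
      exact (h _).2 he.one_sub_mul_self
    · rw [← star_mul_self_of_isStarProjection hp, h] at hφp
      refine hp.le_of_mul_eq_left he.one_sub ?_
      rw [mul_sub, mul_one, hφp, sub_zero]
  refine ⟨fun h => ?_, fun h => of_annihilator e h.1 h.2⟩
  obtain ⟨f, hf, hfa⟩ := hn.exists_isStarProjection_mul_eq_zero_iff hp
  rw [sub_right_inj.1 (IsGreatest.unique h (of_annihilator f hf hfa))]
  exact ⟨hf, hfa⟩

theorem IsNormal.exists_isFunctionalSupport {φ : Elt M →ₗ[ℂ] ℂ} (hn : IsNormal φ)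
    (hp : IsPositive φ) : ∃ e, IsFunctionalSupport φ e := by
  simpa only [isFunctionalSupport_iff hn hp] using hn.exists_isStarProjection_mul_eq_zero_iff hp

end Supports

section Sequences

variable {E : Type*} [NormedAddCommGroup E]

theorem exists_pos_norm_smul_le_pow [NormedSpace ℂ E] (v : ℕ → E) :
    ∃ c : ℕ → ℝ, (∀ n, 0 < c n) ∧ ∀ n, ‖(c n : ℂ) • v n‖ ≤ (1 / 2) ^ n := by
  refine ⟨fun n => (1 / 2) ^ n / (1 + ‖v n‖), fun n => by positivity, fun n => ?_⟩
  rw [norm_smul, Complex.norm_real, Real.norm_of_nonneg (by positivity), div_mul_eq_mul_div]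
  refine div_le_of_le_mul₀ (by positivity) (by positivity) ?_
  gcongr
  linarith

theorem summable_norm_sq_of_le_pow {v : ℕ → E} (hv : ∀ n, ‖v n‖ ≤ (1 / 2) ^ n) :
    Summable fun n => ‖v n‖ ^ 2 := by
  refine Summable.of_nonneg_of_le (fun n => by positivity) (fun n => ?_)
    (summable_geometric_of_lt_one (r := 1 / 4) (by norm_num) (by norm_num))
  calc ‖v n‖ ^ 2 ≤ ((1 / 2) ^ n) ^ 2 := by gcongr; exact hv n
    _ = (1 / 4) ^ n := by rw [← pow_mul, mul_comm, pow_mul]; norm_num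

theorem exists_isGreatest_of_seq {P : Type*} [PartialOrder P] {S : Set P} {f : P → ℝ}
    (hf : StrictMonoOn f S) (hbdd : BddAbove (f '' S)) (hne : S.Nonempty)
    (hseq : ∀ p : ℕ → P, (∀ n, p n ∈ S) → ∃ q ∈ S, ∀ n, p n ≤ q) : ∃ e, IsGreatest S e := by
  obtain ⟨u, -, hu, huS⟩ := exists_seq_tendsto_sSup (hne.image f) hbdd
  choose p hpS hpu using huS
  obtain ⟨e, heS, he⟩ := hseq p hpS
  have hmax : ∀ q ∈ S, f q ≤ f e := fun q hq =>
    (le_csSup hbdd ⟨q, hq, rfl⟩).trans <| le_of_tendsto' hu fun n =>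
      (hpu n).symm.trans_le (hf.monotoneOn (hpS n) heS (he n))
  refine ⟨e, heS, fun q hq => ?_⟩
  obtain ⟨r, hrS, hr⟩ := hseq (fun n => if n = 0 then e else q) fun n => by
    split_ifs <;> assumption
  have her : e = r :=
    (by simpa using hr 0 : e ≤ r).eq_of_not_lt fun hlt => (hf heS hrS hlt).not_ge (hmax r hrS)
  rw [her]
  simpa using hr 1

end Sequences

section SigmaFinite

variable {H : Type*} [NormedAddCommGroup H] [InnerProductSpace ℂ H] [CompleteSpace H]
variable {M : VonNeumannAlgebra H}

variable (M) in
theorem exists_separating_pairwise_isVectorSupport :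
    ∃ T : Set (Elt M), (∀ p ∈ T, ∃ ξ, ξ ≠ 0 ∧ IsVectorSupport {ξ} p) ∧
      T.Pairwise (fun p q => p * q = 0) ∧ ∀ x : Elt M, (∀ p ∈ T, x * p = 0) → x = 0 := by
  obtain ⟨T, ⟨hTS, hTpair⟩, hTmax⟩ := zorn_subset
    {T : Set (Elt M) | (∀ p ∈ T, ∃ ξ, ξ ≠ 0 ∧ IsVectorSupport {ξ} p) ∧
      T.Pairwise fun p q => p * q = 0} fun c hc hchain =>
    ⟨⋃₀ c, ⟨fun p ⟨t, ht, hpt⟩ => (hc ht).1 p hpt,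
      (Set.pairwise_sUnion hchain.directedOn).2 fun t ht => (hc ht).2⟩,
      fun s hs => Set.subset_sUnion_of_mem hs⟩
  refine ⟨T, hTS, hTpair, fun x hx => ?_⟩
  have hTx : ∀ r ∈ T, r * star x = 0 := fun r hr => by
    obtain ⟨ξ, -, hrξ⟩ := hTS r hr
    simpa [hrξ.isStarProjection.isSelfAdjoint.star_eq] using congrArg star (hx r hr)
  rw [← star_eq_zero, eq_zero_iff_forall_apply]
  by_contra! ⟨η, hη⟩
  obtain ⟨q, hq⟩ := exists_isVectorSupport M {((star x : Elt M) : H →L[ℂ] H) η}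
  have hTq : ∀ r ∈ T, r * q = 0 := fun r hr => (hq.mul_eq_zero_iff r).2 <| by
    rintro _ rfl
    exact eq_zero_iff_forall_apply.1 (hTx r hr) η
  have hqT : q ∈ T := by
    refine hTmax (y := insert q T) ⟨?_, ?_⟩ (Set.subset_insert _ _) (Set.mem_insert _ _)
    · exact Set.forall_mem_insert.2 ⟨⟨_, hη, hq⟩, hTS⟩
    · refine Set.pairwise_insert.2 ⟨hTpair, fun r hr _ => ⟨?_, hTq r hr⟩⟩
      obtain ⟨ξ, -, hrξ⟩ := hTS r hr
      exact mul_eq_zero_comm_of_isSelfAdjoint hrξ.isStarProjection.isSelfAdjoint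
        hq.isStarProjection.isSelfAdjoint (hTq r hr)
  exact hq.ne_zero hη (hq.isStarProjection.isIdempotentElem.eq.symm.trans (hTq q hqT))

theorem IsSigmaFinite.exists_separating_seq (hσ : IsSigmaFinite M) :
    ∃ ξ : ℕ → H, ∀ x : Elt M, (∀ n, (x : H →L[ℂ] H) (ξ n) = 0) → x = 0 := by
  obtain ⟨T, hT, hTpair, hTsep⟩ := exists_separating_pairwise_isVectorSupport M
  choose! v hv0 hv using hT
  have hTc : T.Countable :=
    hσ T (fun p hp => ⟨(hv p hp).isStarProjection, (hv p hp).ne_zero (hv0 p hp)⟩) hTpair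
  obtain ⟨ξ, hξ⟩ := ((hTc.image v).insert 0).exists_eq_range (Set.insert_nonempty _ _)
  refine ⟨ξ, fun x hx => hTsep x fun p hp => ((hv p hp).mul_eq_zero_iff x).2 ?_⟩
  obtain ⟨n, hn⟩ : v p ∈ Set.range ξ := hξ ▸ Set.mem_insert_of_mem _ (Set.mem_image_of_mem v hp)
  rintro _ rfl
  exact hn ▸ hx n

theorem IsSigmaFinite.exists_faithful (hσ : IsSigmaFinite M) :
    ∃ φ : Elt M →ₗ[ℂ] ℂ, IsNormal φ ∧ IsPositive φ ∧ ∀ x, 0 < x → 0 < (φ x).re := by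
  obtain ⟨ξ, hξ⟩ := hσ.exists_separating_seq
  obtain ⟨c, hc, hcξ⟩ := exists_pos_norm_smul_le_pow ξ
  have hmem : Memℓp (fun n => (c n : ℂ) • ξ n) 2 :=
    (memℓp_gen_iff (by norm_num)).2 <| by simpa using summable_norm_sq_of_le_pow hcξ
  have hp := isPositive_matrixCoeff (stdRep M) ⟨_, hmem⟩
  refine ⟨_, isNormal_matrixCoeff_stdRep ⟨_, hmem⟩ ⟨_, hmem⟩, hp, fun x hx => ?_⟩
  refine (hp.re_nonneg hx.le).lt_of_ne' fun hzero => hx.ne' ?_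
  obtain ⟨s, rfl⟩ := CStarAlgebra.nonneg_iff_eq_star_mul_self.1 hx.le
  have hsξ := (matrixCoeff_stdRep_star_mul_self_eq_zero_iff ⟨_, hmem⟩ s).1 <| by
    rw [hp.eq_ofReal_re hx.le, hzero, Complex.ofReal_zero]
  rw [hξ s fun n => ?_, mul_zero]
  have hcn : (c n : ℂ) • (s : H →L[ℂ] H) (ξ n) = 0 := by
    rw [← map_smul]
    exact hsξ n
  exact (smul_eq_zero.1 hcn).resolve_left (Complex.ofReal_ne_zero.2 (hc n).ne')

theorem IsSigmaFinite.exists_isGreatest (hσ : IsSigmaFinite M) {S : Set (Elt M)}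
    (hS : BddAbove S) (hne : S.Nonempty)
    (hseq : ∀ p : ℕ → Elt M, (∀ n, p n ∈ S) → ∃ q ∈ S, ∀ n, p n ≤ q) :
    ∃ e, IsGreatest S e := by
  obtain ⟨φ, -, -, hφ⟩ := hσ.exists_faithful
  have hmono : StrictMono fun x => (φ x).re := fun p q hpq => by
    simpa using hφ (q - p) (sub_pos.2 hpq)
  exact exists_isGreatest_of_seq (hmono.strictMonoOn S) (hmono.monotone.map_bddAbove hS) hne hseq

end SigmaFinite

section InvariantSupports

variable {H : Type*} [NormedAddCommGroup H] [InnerProductSpace ℂ H] [CompleteSpace H]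
variable {M : VonNeumannAlgebra H} {G : Type*} {α : G → (Elt M →L[ℂ] Elt M)}

theorem IsInvariantNormalState.isInvariantFunctional {ρ : Elt M →ₗ[ℂ] ℂ}
    (hρ : IsInvariantNormalState α ρ) : IsInvariantFunctional α ρ :=
  ⟨hρ.1.normal, hρ.1.isPositive, hρ.2⟩

theorem isInvariantFunctional_zero : IsInvariantFunctional α 0 where
  normal := isNormal_iff_exists_matrixCoeff.2
    ⟨0, 0, LinearMap.ext fun x => by simp [matrixCoeff_apply]⟩
  positive _ _ := le_rfl
  invariant _ _ := rfl

theorem IsNormal.smul {φ : Elt M →ₗ[ℂ] ℂ} (hφ : IsNormal φ) (c : ℂ) : IsNormal (c • φ) := by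
  obtain ⟨ξ, η, rfl⟩ := isNormal_iff_exists_matrixCoeff.1 hφ
  refine isNormal_iff_exists_matrixCoeff.2 ⟨ξ, c • η, LinearMap.ext fun x => ?_⟩
  simp only [LinearMap.smul_apply, matrixCoeff_apply, map_smul, inner_smul_right, smul_eq_mul]

theorem IsInvariantFunctional.normalize {φ : Elt M →ₗ[ℂ] ℂ} (hφ : IsInvariantFunctional α φ)
    (hφ1 : φ 1 ≠ 0) : IsInvariantNormalState α ((φ 1)⁻¹ • φ) := by
  refine ⟨⟨hφ.normal.smul _, fun x => ?_, inv_mul_cancel₀ hφ1⟩, fun g x => ?_⟩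
  · exact mul_nonneg (inv_nonneg.2 (hφ.positive 1 zero_le_one))
      (hφ.positive _ (star_mul_self_nonneg x))
  · rw [LinearMap.smul_apply, hφ.invariant, LinearMap.smul_apply]

theorem isFunctionalSupport_smul {φ : Elt M →ₗ[ℂ] ℂ} {c : ℂ} (hc : c ≠ 0) {e : Elt M} :
    IsFunctionalSupport (c • φ) e ↔ IsFunctionalSupport φ e := by
  simp only [IsFunctionalSupport, LinearMap.smul_apply, smul_eq_zero, hc, false_or]

theorem IsFunctionalSupport.eq_zero_iff {φ : Elt M →ₗ[ℂ] ℂ} {e : Elt M}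
    (he : IsFunctionalSupport φ e) (hn : IsNormal φ) (hp : IsPositive φ) : e = 0 ↔ φ 1 = 0 := by
  simpa using (((isFunctionalSupport_iff hn hp).1 he).2 1).symm

theorem exists_isNormal_hasSum {φ : ℕ → Elt M →ₗ[ℂ] ℂ} (hn : ∀ n, IsNormal (φ n))
    (hp : ∀ n, IsPositive (φ n)) :
    ∃ (c : ℕ → ℝ) (ψ : Elt M →ₗ[ℂ] ℂ), (∀ n, 0 < c n) ∧ IsNormal ψ ∧ IsPositive ψ ∧
      ∀ x, 0 ≤ x → HasSum (fun n => c n * (φ n x).re) (ψ x).re := by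
  choose ζ hζ using fun n => (hn n).exists_eq_matrixCoeff_self (hp n)
  obtain ⟨c, hc, hcζ⟩ := exists_pos_norm_smul_le_pow ζ
  obtain ⟨Z, hZ⟩ := isAmple_stdRep M _ (summable_norm_sq_of_le_pow hcζ)
  refine ⟨fun n => c n ^ 2, matrixCoeff (stdRep M) Z Z, fun n => pow_pos (hc n) 2,
    isNormal_matrixCoeff_stdRep _ _, isPositive_matrixCoeff _ Z, fun x hx => ?_⟩
  obtain ⟨s, rfl⟩ := CStarAlgebra.nonneg_iff_eq_star_mul_self.1 hx
  have hre (v : lp (fun _ : ℕ => H) 2) :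
      (matrixCoeff (stdRep M) v v (star s * s)).re = ‖stdRep M s v‖ ^ 2 := by
    rw [matrixCoeff_star_mul_self, ← Complex.ofReal_pow, Complex.ofReal_re]
  rw [hre]
  refine (hZ s).congr_fun fun n => ?_
  rw [hζ n, hre, map_smul, norm_smul, Complex.norm_real, mul_pow, Real.norm_eq_abs, sq_abs]

theorem exists_isInvariantFunctional_dominating (hα : ∀ g x, 0 ≤ x → 0 ≤ α g x)
    {φ : ℕ → Elt M →ₗ[ℂ] ℂ} (hφ : ∀ n, IsInvariantFunctional α (φ n)) :
    ∃ ψ, IsInvariantFunctional α ψ ∧ ∀ x, 0 ≤ x → ψ x = 0 → ∀ n, φ n x = 0 := by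
  obtain ⟨c, ψ, hc, hψn, hψp, hsum⟩ :=
    exists_isNormal_hasSum (fun n => (hφ n).normal) fun n => (hφ n).positive
  refine ⟨ψ, ⟨hψn, hψp, fun g => ?_⟩, fun x hx hψx n => ?_⟩
  · suffices h : ψ ∘ₗ (α g : Elt M →ₗ[ℂ] Elt M) = ψ from DFunLike.congr_fun h
    refine linearMap_ext_of_nonneg fun x hx => ?_
    change ψ (α g x) = ψ x
    rw [hψp.eq_ofReal_re hx, hψp.eq_ofReal_re (hα g x hx)]
    refine congrArg _ ((hsum _ (hα g x hx)).unique ?_)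
    simpa only [(hφ _).invariant] using hsum x hx
  · have hterm (k : ℕ) : 0 ≤ c k * (φ k x).re :=
      mul_nonneg (hc k).le ((hφ k).positive.re_nonneg hx)
    have hzero := hsum x hx
    rw [hψx, Complex.zero_re, hasSum_zero_iff_of_nonneg hterm] at hzero
    rw [(hφ n).positive.eq_ofReal_re hx, Complex.ofReal_eq_zero]
    exact (mul_eq_zero.1 (congrFun hzero n)).resolve_left (hc n).ne'

/-- The projections that are supports of invariant positive normal functionals; `0` is one of them,
since functionals are not normalized here. -/
def invariantSupports (α : G → (Elt M →L[ℂ] Elt M)) : Set (Elt M) :=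
  {e | ∃ φ, IsInvariantFunctional α φ ∧ IsFunctionalSupport φ e}

theorem exists_isGreatest_invariantSupports (hσ : IsSigmaFinite M)
    (hα : ∀ g x, 0 ≤ x → 0 ≤ α g x) : ∃ e, IsGreatest (invariantSupports α) e := by
  refine hσ.exists_isGreatest ⟨1, ?_⟩ ?_ fun p hp => ?_
  · rintro p ⟨φ, hφ, hp⟩
    exact ((isFunctionalSupport_iff hφ.normal hφ.positive).1 hp).1.le_one
  · have hzero := isInvariantFunctional_zero (α := α)
    obtain ⟨e, he⟩ := hzero.normal.exists_isFunctionalSupport hzero.positive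
    exact ⟨e, 0, hzero, he⟩
  · choose φ hφ hφp using hp
    obtain ⟨ψ, hψ, hψφ⟩ := exists_isInvariantFunctional_dominating hα hφ
    obtain ⟨q, hq⟩ := hψ.normal.exists_isFunctionalSupport hψ.positive
    refine ⟨q, ⟨ψ, hψ, hq⟩, fun n => ?_⟩
    obtain ⟨hqp, -⟩ := (isFunctionalSupport_iff hψ.normal hψ.positive).1 hq
    obtain ⟨hpn, hφn⟩ := (isFunctionalSupport_iff (hφ n).normal (hφ n).positive).1 (hφp n)
    rw [← one_sub_mul_eq_zero_iff_le hpn hqp, ← hφn,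
      star_mul_self_of_isStarProjection hqp.one_sub]
    exact hψφ _ hqp.one_sub.nonneg hq.1.2 n

theorem exists_isInvariantNormalState_or_eq_zero {e : Elt M}
    (he : IsGreatest (invariantSupports α) e) :
    (∃ ρ, IsInvariantNormalState α ρ ∧ IsFunctionalSupport ρ e) ∨
      (e = 0 ∧ ¬ ∃ ρ, IsInvariantNormalState α ρ) := by
  obtain ⟨⟨φ, hφ, hφe⟩, hmax⟩ := he
  by_cases hφ1 : φ 1 = 0
  · have he0 : e = 0 := (hφe.eq_zero_iff hφ.normal hφ.positive).2 hφ1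
    refine .inr ⟨he0, fun ⟨ρ, hρ⟩ => ?_⟩
    have hρ' := hρ.isInvariantFunctional
    obtain ⟨f, hf⟩ := hρ'.normal.exists_isFunctionalSupport hρ'.positive
    have hfp := ((isFunctionalSupport_iff hρ'.normal hρ'.positive).1 hf).1
    have hf0 : f = 0 := le_antisymm (he0 ▸ hmax ⟨ρ, hρ', hf⟩) hfp.nonneg
    have hρ1 : ρ 1 = 0 := (hf.eq_zero_iff hρ'.normal hρ'.positive).1 hf0
    exact one_ne_zero (hρ.1.map_one.symm.trans hρ1)
  · exact .inl ⟨_, hφ.normalize hφ1, (isFunctionalSupport_smul (inv_ne_zero hφ1)).2 hφe⟩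

end InvariantSupports

section Decomposition

variable {H : Type*} [NormedAddCommGroup H] [InnerProductSpace ℂ H] [CompleteSpace H]
variable {M : VonNeumannAlgebra H} {G : Type*} {α : G → (Elt M →L[ℂ] Elt M)}
variable [MeasurableSpace G] {m : Measure G} {ι : Type*} [Preorder ι] {K : ι → Set G}
  {A : ι → Elt M →ₗ[ℂ] Elt M}

theorem IsAveraging.exists_isWeaklyWandering_dominating (hA : IsAveraging α m K A)
    {x : ℕ → Elt M} (hx : ∀ n, IsWeaklyWandering α m K (x n)) :
    ∃ z, IsWeaklyWandering α m K z ∧ ∀ y : Elt M, y * z = 0 → ∀ n, y * x n = 0 := by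
  obtain ⟨c, hc, hbound⟩ := exists_pos_norm_smul_le_pow x
  have hgeom : Summable fun n : ℕ => (1 / 2 : ℝ) ^ n := summable_geometric_two
  have hsum : Summable fun n => (c n : ℂ) • x n := .of_norm_bounded hgeom hbound
  have hnonneg (n : ℕ) : 0 ≤ (c n : ℂ) • x n := by
    rw [Complex.coe_smul]
    exact smul_nonneg (hc n).le (hx n).1
  refine ⟨∑' n, (c n : ℂ) • x n, hA.isWeaklyWandering_iff.2 ⟨tsum_nonneg hnonneg, ?_⟩,
    fun y hy n => ?_⟩
  · have hmap (i : ι) : A i (∑' n, (c n : ℂ) • x n) = ∑' n, A i ((c n : ℂ) • x n) :=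
      ((A i).mkContinuous 1 fun x => by simpa using hA.norm_le i x).map_tsum hsum
    simp only [hmap]
    rw [← tsum_zero (β := ℕ)]
    refine tendsto_tsum_of_dominated_convergence hgeom (fun n => ?_)
      (.of_forall fun i n => (hA.norm_le i _).trans (hbound n))
    simpa only [map_smul, smul_zero] using
      (hA.isWeaklyWandering_iff.1 (hx n)).2.const_smul (c n : ℂ)
  · have hyn := mul_eq_zero_of_le (hnonneg n) (hsum.le_tsum n fun k _ => hnonneg k) hy
    rw [mul_smul_comm] at hyn
    exact (smul_eq_zero.1 hyn).resolve_left (Complex.ofReal_ne_zero.2 (hc n).ne')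

/-- The projections that are supports of weakly wandering operators. -/
def wanderingSupports (α : G → (Elt M →L[ℂ] Elt M)) (m : Measure G) (K : ι → Set G) :
    Set (Elt M) :=
  {e | ∃ x, IsWeaklyWandering α m K x ∧ IsOperatorSupport x e}

theorem IsAveraging.exists_isGreatest_wanderingSupports (hσ : IsSigmaFinite M)
    (hA : IsAveraging α m K A) : ∃ e, IsGreatest (wanderingSupports α m K) e := by
  refine hσ.exists_isGreatest ⟨1, ?_⟩ ?_ fun p hp => ?_
  · rintro p ⟨x, -, hp⟩
    exact hp.1.1.le_one
  · obtain ⟨e, he⟩ := exists_isOperatorSupport (0 : Elt M)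
    exact ⟨e, 0, hA.isWeaklyWandering_iff.2 ⟨le_rfl, by simpa using tendsto_const_nhds⟩, he⟩
  · choose x hx hxp using hp
    obtain ⟨z, hz, hzx⟩ := hA.exists_isWeaklyWandering_dominating hx
    obtain ⟨q, hq⟩ := exists_isOperatorSupport z
    refine ⟨q, ⟨z, hz, hq⟩, fun n => ?_⟩
    obtain ⟨hqp, hzq⟩ := isOperatorSupport_iff.1 hq
    obtain ⟨hpn, hxn⟩ := isOperatorSupport_iff.1 (hxp n)
    rw [← one_sub_mul_eq_zero_iff_le hpn hqp, ← hxn]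
    exact hzx _ ((hzq _).2 hqp.one_sub_mul_self) n

theorem IsInvariantFunctional.map_average {φ : Elt M →ₗ[ℂ] ℂ} (hφ : IsInvariantFunctional α φ)
    {B : Set G} (hB0 : 0 < m B) (hB : m B < ∞) {x y : Elt M} (hy : IsAverage α m B x y) :
    φ y = φ x := by
  rw [hy φ hφ.normal]
  simp only [hφ.invariant]
  rw [setIntegral_const, smul_smul, inv_mul_cancel₀, one_smul]
  exact (ENNReal.toReal_pos hB0.ne' hB.ne).ne'

theorem IsAveraging.eq_zero_of_mul_supports_eq_zero [Nonempty ι] [IsDirectedOrder ι] [Semigroup G]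
    [TopologicalSpace G] (hσ : IsSigmaFinite M) (hα : IsDynamicalSystem α)
    (hA : IsAveraging α m K A) {e₁ e₂ p : Elt M} (he₁ : IsGreatest (invariantSupports α) e₁)
    (he₂ : IsGreatest (wanderingSupports α m K) e₂) (hp : IsStarProjection p) (hp₁ : p * e₁ = 0)
    (hp₂ : p * e₂ = 0) : p = 0 := by
  obtain ⟨φ, hφ, hφe⟩ := he₁.1
  have he₁p := ((isFunctionalSupport_iff hφ.normal hφ.positive).1 hφe).1
  obtain ⟨x, -, hxe⟩ := he₂.1
  have he₂p := hxe.1.1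
  have hθp : ∀ θ, IsInvariantFunctional α θ → θ p = 0 := fun θ hθ => by
    obtain ⟨f, hf⟩ := hθ.normal.exists_isFunctionalSupport hθ.positive
    obtain ⟨hfp, hθf⟩ := (isFunctionalSupport_iff hθ.normal hθ.positive).1 hf
    have hle : f ≤ e₁ := he₁.2 ⟨θ, hθ, hf⟩
    rw [← star_mul_self_of_isStarProjection hp, hθf, ← (hfp.le_iff_mul_eq_right he₁p).1 hle,
      ← mul_assoc, hp₁, zero_mul]
  obtain ⟨ω, hωn, hωp, hω⟩ := hσ.exists_faithful
  by_contra hp0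
  obtain ⟨w, hw, hwp, hw0⟩ := hA.exists_isWeaklyWandering_le hα hp.nonneg hθp hωn hωp
    (hω p (hp.nonneg.lt_of_ne' hp0))
  obtain ⟨f, hf⟩ := exists_isOperatorSupport w
  obtain ⟨hfp, hwf⟩ := isOperatorSupport_iff.1 hf
  have hle : f ≤ e₂ := he₂.2 ⟨w, hw, hf⟩
  have he₂w : e₂ * w = 0 := mul_eq_zero_of_le hw.1 hwp
    (mul_eq_zero_comm_of_isSelfAdjoint hp.isSelfAdjoint he₂p.isSelfAdjoint hp₂)
  have hf0 : f = 0 := by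
    rw [← (hfp.le_iff_mul_eq_right he₂p).1 hle]
    exact (hwf e₂).1 he₂w
  exact hw0 (by simpa [hf0] using hwf 1)

variable [Semigroup G] [Nonempty ι] [IsDirectedOrder ι]

theorem IsInvariantFunctional.map_eq_zero {φ : Elt M →ₗ[ℂ] ℂ} (hφ : IsInvariantFunctional α φ)
    (hK : IsFolnerNet m K) {x : Elt M} (hx : IsWeaklyWandering α m K x) : φ x = 0 := by
  obtain ⟨-, B, hB, hlim⟩ := hx
  obtain ⟨C, -, hC⟩ := hφ.normal.exists_bound
  have hφx : Tendsto (fun _ : ι => φ x) atTop (𝓝 0) := by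
    refine squeeze_zero_norm (fun i => ?_) (by simpa using hlim.const_mul C)
    rw [← hφ.map_average (hK.pos i) (hK.finite i) (hB i)]
    exact hC _
  exact tendsto_nhds_unique tendsto_const_nhds hφx

theorem IsInvariantFunctional.support_mul_support {φ : Elt M →ₗ[ℂ] ℂ}
    (hφ : IsInvariantFunctional α φ) (hK : IsFolnerNet m K) {x e f : Elt M}
    (hx : IsWeaklyWandering α m K x) (he : IsFunctionalSupport φ e) (hf : IsOperatorSupport x f) :
    e * f = 0 := by
  have hφx := hφ.map_eq_zero hK hx
  obtain ⟨he, hφe⟩ := (isFunctionalSupport_iff hφ.normal hφ.positive).1 he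
  obtain ⟨-, hxf⟩ := isOperatorSupport_iff.1 hf
  obtain ⟨s, rfl⟩ := CStarAlgebra.nonneg_iff_eq_star_mul_self.1 hx.1
  refine (hxf e).1 (mul_eq_zero_comm_of_isSelfAdjoint hx.1.isSelfAdjoint he.isSelfAdjoint ?_)
  rw [mul_assoc, (hφe s).1 hφx, mul_zero]

theorem IsNeveuDecomposition.snd_le (hK : IsFolnerNet m K) {e₁ e₂ f₁ f₂ : Elt M}
    (he : IsNeveuDecomposition α m K e₁ e₂) (hf : IsNeveuDecomposition α m K f₁ f₂) :
    f₂ ≤ e₂ := by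
  rw [← one_sub_mul_eq_zero_iff_le hf.isStarProjection_snd he.isStarProjection_snd,
    ← he.add_eq_one, add_sub_cancel_right]
  obtain ⟨x, hx, hxf⟩ := hf.wandering
  rcases he.invariant with ⟨ρ, hρ, hρe⟩ | ⟨he₁, -⟩
  · exact hρ.isInvariantFunctional.support_mul_support hK hx hρe hxf
  · rw [he₁, zero_mul]

theorem IsNeveuDecomposition.unique (hK : IsFolnerNet m K) {e₁ e₂ f₁ f₂ : Elt M}
    (he : IsNeveuDecomposition α m K e₁ e₂) (hf : IsNeveuDecomposition α m K f₁ f₂) :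
    f₁ = e₁ ∧ f₂ = e₂ := by
  have hsnd : f₂ = e₂ := le_antisymm (he.snd_le hK hf) (hf.snd_le hK he)
  refine ⟨?_, hsnd⟩
  rw [eq_sub_of_add_eq he.add_eq_one, eq_sub_of_add_eq hf.add_eq_one, hsnd]

theorem IsAveraging.exists_isNeveuDecomposition [TopologicalSpace G] (hσ : IsSigmaFinite M)
    (hα : IsDynamicalSystem α) (hK : IsFolnerNet m K) (hA : IsAveraging α m K A) :
    ∃ e₁ e₂ : Elt M, IsNeveuDecomposition α m K e₁ e₂ := by
  obtain ⟨e₁, he₁⟩ := exists_isGreatest_invariantSupports hσ hα.positive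
  obtain ⟨e₂, he₂⟩ := hA.exists_isGreatest_wanderingSupports hσ
  obtain ⟨φ, hφ, hφe⟩ := he₁.1
  obtain ⟨x, hx, hxe⟩ := he₂.1
  have he₁p := ((isFunctionalSupport_iff hφ.normal hφ.positive).1 hφe).1
  have he₂p := hxe.1.1
  have horth : e₁ * e₂ = 0 := hφ.support_mul_support hK hx hφe hxe
  have horth' : e₂ * e₁ = 0 :=
    mul_eq_zero_comm_of_isSelfAdjoint he₁p.isSelfAdjoint he₂p.isSelfAdjoint horth
  have hle : e₂ ≤ 1 - e₁ :=
    he₂p.le_of_mul_eq_left he₁p.one_sub (by rw [mul_sub, mul_one, horth', sub_zero])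
  have hrest : 1 - e₁ - e₂ = 0 := by
    refine hA.eq_zero_of_mul_supports_eq_zero hσ hα he₁ he₂
      ((he₂p.le_iff_sub he₁p.one_sub).1 hle) ?_ ?_
    · rw [sub_mul, he₁p.one_sub_mul_self, horth', sub_zero]
    · rw [sub_mul, sub_mul, one_mul, horth, he₂p.isIdempotentElem.eq, sub_zero, sub_self]
  refine ⟨e₁, e₂, he₁p, he₂p, ?_, exists_isInvariantNormalState_or_eq_zero he₁, x, hx, hxe⟩
  rwa [sub_sub, sub_eq_zero, eq_comm] at hrest

end Decomposition

end Neveu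

theorem theorem3p10_general {H : Type*} [NormedAddCommGroup H]
    [InnerProductSpace ℂ H] [CompleteSpace H] (M : VonNeumannAlgebra H) (hσ : Neveu.IsSigmaFinite M)
    {G : Type*} [Semigroup G] [TopologicalSpace G] [ContinuousMul G]
    [SecondCountableTopology G] [MeasurableSpace G] [BorelSpace G]
    (m : MeasureTheory.Measure G) (hm : Neveu.IsBiinvariant m)
    {ι : Type*} [Nonempty ι] [Preorder ι] [IsDirectedOrder ι]
    [(Filter.atTop : Filter ι).IsCountablyGenerated]
    (K : ι → Set G) (hK : Neveu.IsFolnerNet m K)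
    (α : G → (Neveu.Elt M →L[ℂ] Neveu.Elt M)) (hα : Neveu.IsDynamicalSystem α) :
    ∃ e₁ e₂ : Neveu.Elt M, Neveu.IsNeveuDecomposition α m K e₁ e₂ ∧
      ∀ f₁ f₂ : Neveu.Elt M, Neveu.IsNeveuDecomposition α m K f₁ f₂ → f₁ = e₁ ∧ f₂ = e₂ := by
  obtain ⟨A, hA⟩ := Neveu.exists_isAveraging hα hm hK
  obtain ⟨e₁, e₂, he⟩ := hA.exists_isNeveuDecomposition hσ hα hK
  exact ⟨e₁, e₂, he, fun f₁ f₂ hf => he.unique hK hf⟩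

theorem theorem3p10 {H : Type*} [NormedAddCommGroup H] [InnerProductSpace ℂ H] [CompleteSpace H]
    (M : VonNeumannAlgebra H) (hσ : Neveu.IsSigmaFinite M) (hM : Neveu.IsSemifinite M)
    {G : Type*} [Semigroup G] [TopologicalSpace G] [ContinuousMul G] [T2Space G]
    [LocallyCompactSpace G] [SecondCountableTopology G] [MeasurableSpace G] [BorelSpace G]
    (m : MeasureTheory.Measure G) [MeasureTheory.SigmaFinite m] (hm : Neveu.IsBiinvariant m)
    {ι : Type*} [Nonempty ι] [Preorder ι] [IsDirectedOrder ι]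
    [(Filter.atTop : Filter ι).IsCountablyGenerated]
    (K : ι → Set G) (hK : Neveu.IsFolnerNet m K)
    (α : G → (Neveu.Elt M →L[ℂ] Neveu.Elt M)) (hα : Neveu.IsDynamicalSystem α) :
    ∃ e₁ e₂ : Neveu.Elt M, Neveu.IsNeveuDecomposition α m K e₁ e₂ ∧
      ∀ f₁ f₂ : Neveu.Elt M, Neveu.IsNeveuDecomposition α m K f₁ f₂ → f₁ = e₁ ∧ f₂ = e₂ :=
  theorem3p10_general M hσ m hm K hK α hα
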